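/- Let $\ell\neq 0$ be real and let $\alpha\in(-\infty,-\tfrac23)\cup(\tfrac12,2)$. Consider the central force with potential $V(r)=-\tfrac1\alpha r^{-\alpha}$, and put $h^*=\frac{\alpha-2}{2\alpha}|\ell|^{2\alpha/(\alpha-2)}$. The energies $h$ of the bounded non-circular orbits of angular momentum $\ell$, i.e. those for which $h-V(r)-\frac{\ell^2}{2r^2}=0$ has two solutions $0<r_-(h)<r_+(h)$ with $V(r)+\frac{\ell^2}{2r^2}<h$ between them, form the interval $H=(h^*,0)$ if $\alpha>0$ and $H=(h^*,+\infty)$ if $\alpha<0$. For $h\in H$ let $$\Theta_\alpha(h)=\int_{r_-(h)}^{r_+(h)}\frac{|\ell|\,dr}{r^2\sqrt{2\left(h+\frac1\alpha r^{-\alpha}\right)-\frac{\ell^2}{r^2}}}$$ be the apsidal angle (the integral converges), and let $e(h)=\frac{r_+(h)-r_-(h)}{r_+(h)+r_-(h)}$ be the eccentricity. Then $\Theta_\alpha$ is a monotone (not necessarily strictly monotone) function of the energy $h$ on $H$. Moreover: * if $\alpha\in(-2,-\tfrac23)\cup(\tfrac12,1)$, then $\Theta_\alpha$ is differentiable and strictly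 decreasing on $H$, with $\Theta_\alpha'(h)<0$ for all $h\in H$; * if $\alpha\in(-\infty,-2)\cup(1,2)$, then $\Theta_\alpha$ is differentiable and strictly increasing on $H$, with $\Theta_\alpha'(h)>0$ for all $h\in H$. Furthermore, the eccentricity is a differentiable, strictly increasing function of the energy with $e'(h)>0$ on $H$. Consequently $\Theta_\alpha$ is a function of the eccentricity, that is, $\Theta_\alpha(h)=T(e(h))$ for a function $T$ on $e(H)$, and $T$ is monotone for all the above $\alpha$, strictly decreasing with $T'<0$ in the first case, and strictly increasing with $T'>0$ in the second. -/

import Mathlib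

noncomputable section

namespace ApsidalAngle

/-- The power-law potential `V(r) = -r^{-α}/α`. -/
def potential (α r : ℝ) : ℝ := -(1 / α) * r ^ (-α)

/-- The effective radial potential `V(r) + ℓ²/(2r²)`. -/
def effPotential (α ℓ r : ℝ) : ℝ := potential α r + ℓ ^ 2 / (2 * r ^ 2)

/-- The apsidal distances: the radii `r > 0` with `h - V(r) - ℓ²/(2r²) = 0`. -/
def apsides (α ℓ h : ℝ) : Set ℝ := {r | 0 < r ∧ h - potential α r - ℓ ^ 2 / (2 * r ^ 2) = 0}

/-- The energies of the bounded non-circular orbits of angular momentum `ℓ`: those for which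
the radial motion has two distinct turning points, with the region between them allowed. -/
def energies (α ℓ : ℝ) : Set ℝ :=
  {h | ∃ r₁ ∈ apsides α ℓ h, ∃ r₂ ∈ apsides α ℓ h, r₁ < r₂ ∧
    ∀ r ∈ Set.Ioo r₁ r₂, effPotential α ℓ r < h}

/-- The pericenter distance `r₋`. -/
def rMinus (α ℓ h : ℝ) : ℝ := sInf (apsides α ℓ h)

/-- The apocenter distance `r₊`. -/
def rPlus (α ℓ h : ℝ) : ℝ := sSup (apsides α ℓ h)

/-- The integrand of the apsidal angle. The angular momentum enters the numerator through its
absolute value, so that orbits of either orientation have a positive apsidal angle. -/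
def integrand (α ℓ h r : ℝ) : ℝ :=
  |ℓ| / (r ^ 2 * √(2 * (h - potential α r) - ℓ ^ 2 / r ^ 2))

/-- The apsidal angle `Θ_α(h)` at angular momentum `ℓ`. -/
def apsidalAngle (α ℓ h : ℝ) : ℝ :=
  ∫ r in (rMinus α ℓ h)..(rPlus α ℓ h), integrand α ℓ h r

/-- The orbital eccentricity `e = (r₊ - r₋)/(r₊ + r₋)`. -/
def eccentricity (α ℓ h : ℝ) : ℝ :=
  (rPlus α ℓ h - rMinus α ℓ h) / (rPlus α ℓ h + rMinus α ℓ h)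

/-- `f` is strictly decreasing on `s`, with a negative derivative at each point of `s`. -/
def DecreasesOn (f : ℝ → ℝ) (s : Set ℝ) : Prop :=
  StrictAntiOn f s ∧ ∀ x ∈ s, DifferentiableAt ℝ f x ∧ deriv f x < 0

/-- `f` is strictly increasing on `s`, with a positive derivative at each point of `s`. -/
def IncreasesOn (f : ℝ → ℝ) (s : Set ℝ) : Prop :=
  StrictMonoOn f s ∧ ∀ x ∈ s, DifferentiableAt ℝ f x ∧ 0 < deriv f x

end ApsidalAngle

end

/-!
A power of the inverse radius, `x = c r⁻ˢ`, reduces the radial motion to an oscillator with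
potential `x²/2 - x^β/β`, where `β = α` if `0 < α < 2` and `β` is the dual exponent `2α/(α-2)` if
`α < 0`; the apsidal angle becomes `1/s` times the half-period, and the energy of the oscillator
increases with that of the orbit. In the coordinate `y = ±√(2U)` of a potential well `U` the
half-period at amplitude `a` is `∫ X'(a sin θ) dθ` over `|θ| ≤ π/2`, where `x = X(y)`, and its
derivative `∫ X''(a sin θ) sin θ dθ` has a sign as soon as `X''` is strictly monotone. By Chicone's
formula for `X'''` this is a condition on `U` and its first three derivatives. Schaaf's argument
reduces it to the sign of `5 U'''² - 3 U'' U''''`, which is negative for `1/2 < β < 1` and positive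
for `1 < β < 2` where `U'' > 0`; at the points left out by the argument the condition can be read
off directly.
-/

noncomputable section

namespace ApsidalAngle

open Set Filter Topology MeasureTheory

section Calculus

theorem analyticOnNhd_dslope {𝕜 E : Type*} [NontriviallyNormedField 𝕜] [NormedAddCommGroup E]
    [NormedSpace 𝕜 E] {f : 𝕜 → E} {s : Set 𝕜} {a : 𝕜} (hf : AnalyticOnNhd 𝕜 f s) (ha : a ∈ s) :
    AnalyticOnNhd 𝕜 (dslope f a) s := by
  intro x hx
  rcases eq_or_ne x a with rfl | hne
  · obtain ⟨p, hp⟩ := hf x ha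
    exact ⟨_, hp.has_fpower_series_dslope_fslope⟩
  · refine AnalyticAt.congr ?_ (dslope_eventuallyEq_slope_of_ne f hne).symm
    simp only [slope_fun_def]
    exact ((analyticAt_id.sub analyticAt_const).inv (sub_ne_zero.2 hne)).smul
      ((hf x hx).sub analyticAt_const)

theorem hasDerivAt_iteratedDeriv_of_analyticAt {f : ℝ → ℝ} {x : ℝ} (hf : AnalyticAt ℝ f x)
    (n : ℕ) : HasDerivAt (iteratedDeriv n f) (iteratedDeriv (n + 1) f x) x := by
  rw [iteratedDeriv_succ, iteratedDeriv_eq_iterate]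
  exact (hf.iterated_deriv n).differentiableAt.hasDerivAt

theorem iteratedDeriv_succ_eq_of_hasDerivAt {f g : ℝ → ℝ} {g' x : ℝ} {n : ℕ}
    (hfg : iteratedDeriv n f =ᶠ[𝓝 x] g) (hg : HasDerivAt g g' x) :
    iteratedDeriv (n + 1) f x = g' := by
  rw [iteratedDeriv_succ, hfg.deriv_eq, hg.deriv]

theorem exists_ratio_hasDerivAt_eq_ratio_slope_uIoo {f f' g g' : ℝ → ℝ} {a b : ℝ} (hab : a ≠ b)
    (hf : ∀ x ∈ uIcc a b, HasDerivAt f (f' x) x) (hg : ∀ x ∈ uIcc a b, HasDerivAt g (g' x) x) :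
    ∃ c ∈ uIoo a b, (g b - g a) * f' c = (f b - f a) * g' c := by
  wlog hlt : a < b generalizing a b
  · rw [uIcc_comm] at hf hg
    obtain ⟨c, hc, h⟩ := this hab.symm hf hg (hab.lt_or_gt.resolve_left hlt)
    exact ⟨c, uIoo_comm a b ▸ hc, by linarith⟩
  rw [uIcc_of_le hlt.le] at hf hg
  rw [uIoo_of_le hlt.le]
  exact exists_ratio_hasDerivAt_eq_ratio_slope f f' hlt
    (fun x hx => (hf x hx).continuousAt.continuousWithinAt)
    (fun x hx => hf x (Ioo_subset_Icc_self hx)) g g'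
    (fun x hx => (hg x hx).continuousAt.continuousWithinAt)
    (fun x hx => hg x (Ioo_subset_Icc_self hx))

theorem strictMonoOn_of_hasDerivAt_pos_of_ne {f f' : ℝ → ℝ} {s : Set ℝ} {c : ℝ} (hs : Convex ℝ s)
    (hc : c ∈ s) (hf : ContinuousOn f s) (hd : ∀ x ∈ s, x ≠ c → HasDerivAt f (f' x) x)
    (hpos : ∀ x ∈ s, x ≠ c → 0 < f' x) : StrictMonoOn f s := by
  have strictMonoOn_inter {t : Set ℝ} (ht : Convex ℝ t) (hct : c ∉ interior t) :
      StrictMonoOn f (s ∩ t) := by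
    refine strictMonoOn_of_deriv_pos (hs.inter ht) (hf.mono inter_subset_left) fun x hx => ?_
    rw [interior_inter] at hx
    have hxc : x ≠ c := fun h => hct (h ▸ hx.2)
    rw [(hd x (interior_subset hx.1) hxc).deriv]
    exact hpos x (interior_subset hx.1) hxc
  rw [← inter_univ s, ← Iic_union_Ici (a := c), inter_union_distrib_left]
  exact (strictMonoOn_inter (convex_Iic c) (by simp)).union
    (strictMonoOn_inter (convex_Ici c) (by simp)) ⟨⟨hc, self_mem_Iic⟩, fun x hx => hx.2⟩
    ⟨⟨hc, self_mem_Ici⟩, fun x hx => hx.2⟩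

theorem hasStrictDerivAt_invFunOn {f : ℝ → ℝ} {f' x : ℝ} {s : Set ℝ} (hs : s ∈ 𝓝 x)
    (hinj : InjOn f s) (hf : HasStrictDerivAt f f' x) (hf' : f' ≠ 0) :
    HasStrictDerivAt (Function.invFunOn f s) f'⁻¹ (f x) :=
  hf.to_local_left_inverse hf' (mem_of_superset hs hinj.leftInvOn_invFunOn)

theorem analyticAt_invFunOn {f : ℝ → ℝ} {x : ℝ} {s : Set ℝ} (hs : s ∈ 𝓝 x)
    (hinj : InjOn f s) (hf : AnalyticAt ℝ f x) (hf' : deriv f x ≠ 0) :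
    AnalyticAt ℝ (Function.invFunOn f s) (f x) :=
  (analyticAt_comp_iff_of_deriv_ne_zero hf hf').1 <|
    analyticAt_id.congr (mem_of_superset hs fun _ hy => (hinj.leftInvOn_invFunOn hy).symm)

theorem mul_sin_mem {J : Set ℝ} (hJ : Convex ℝ J) {a : ℝ} (ha : a ∈ J) (ha' : -a ∈ J) (θ : ℝ) :
    a * Real.sin θ ∈ J := by
  have h := hJ ha ha' (a := (1 + Real.sin θ) / 2) (b := (1 - Real.sin θ) / 2)
    (by linarith [Real.neg_one_le_sin θ]) (by linarith [Real.sin_le_one θ]) (by ring)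
  convert h using 1
  simp only [smul_eq_mul]
  ring

theorem continuous_comp_mul_sin {J : Set ℝ} (hJ : Convex ℝ J) {g : ℝ → ℝ} (hg : ContinuousOn g J)
    {a : ℝ} (ha : a ∈ J) (ha' : -a ∈ J) : Continuous fun θ => g (a * Real.sin θ) :=
  hg.comp_continuous (by fun_prop) (mul_sin_mem hJ ha ha')

theorem hasDerivAt_integral_comp_mul_sin {J : Set ℝ} (hJ : Convex ℝ J) (hJo : IsOpen J)
    {g g' : ℝ → ℝ} (hg : ∀ y ∈ J, HasDerivAt g (g' y) y) (hg' : ContinuousOn g' J) (b c : ℝ)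
    {a : ℝ} (ha : a ∈ J) (ha' : -a ∈ J) :
    HasDerivAt (fun a => ∫ θ in b..c, g (a * Real.sin θ))
      (∫ θ in b..c, g' (a * Real.sin θ) * Real.sin θ) a := by
  obtain ⟨K, hK, haK, hKJ⟩ := exists_compact_subset (hJo.inter hJo.neg) ⟨ha, ha'⟩
  have hgc : ContinuousOn g J := fun y hy => (hg y hy).continuousAt.continuousWithinAt
  have hK_nhds : K ∈ 𝓝 a := mem_interior_iff_mem_nhds.1 haK
  have mem_J {y : ℝ} (hy : y ∈ K) (θ : ℝ) : y * Real.sin θ ∈ J :=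
    mul_sin_mem hJ (hKJ hy).1 (hKJ hy).2 θ
  obtain ⟨C, hC⟩ := (hK.prod (isCompact_Icc (a := b ⊓ c) (b := b ⊔ c))).exists_bound_of_continuousOn
    (f := fun p => g' (p.1 * Real.sin p.2) * Real.sin p.2)
    ((hg'.comp (by fun_prop) fun p hp => mem_J hp.1 p.2).mul (by fun_prop))
  refine (intervalIntegral.hasDerivAt_integral_of_dominated_loc_of_deriv_le (bound := fun _ => C)
    (μ := volume)
    (F := fun a θ => g (a * Real.sin θ))
    (F' := fun a θ => g' (a * Real.sin θ) * Real.sin θ) hK_nhds ?_ ?_ ?_ ?_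
    intervalIntegrable_const ?_).2
  · filter_upwards [hK_nhds] with y hy
    exact (continuous_comp_mul_sin hJ hgc (hKJ hy).1 (hKJ hy).2).aestronglyMeasurable
  · exact (continuous_comp_mul_sin hJ hgc ha ha').intervalIntegrable _ _
  · exact ((continuous_comp_mul_sin hJ hg' ha ha').mul Real.continuous_sin).aestronglyMeasurable
  · exact Eventually.of_forall fun θ hθ y hy => hC (y, θ) ⟨hy, uIoc_subset_uIcc hθ⟩
  · exact Eventually.of_forall fun θ _ y hy =>
      HasDerivAt.comp (h₂ := g) y (hg _ (mem_J hy θ)) (hasDerivAt_mul_const _)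

theorem integral_mul_sin_pos {g : ℝ → ℝ} (hg : Continuous g)
    (hpos : ∀ θ ∈ Ioo 0 (Real.pi / 2), g (-θ) < g θ) :
    0 < ∫ θ in (-(Real.pi / 2))..(Real.pi / 2), g θ * Real.sin θ := by
  have hi (a b : ℝ) : IntervalIntegrable (fun θ => g θ * Real.sin θ) volume a b :=
    (hg.mul Real.continuous_sin).intervalIntegrable _ _
  have hi_neg (a b : ℝ) : IntervalIntegrable (fun θ => g (-θ) * Real.sin (-θ)) volume a b :=
    ((hg.mul Real.continuous_sin).comp continuous_neg).intervalIntegrable _ _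
  have integral_reflect : ∫ θ in (-(Real.pi / 2))..0, g θ * Real.sin θ
      = ∫ θ in (0 : ℝ)..(Real.pi / 2), g (-θ) * Real.sin (-θ) := by
    rw [intervalIntegral.integral_comp_neg fun θ => g θ * Real.sin θ, neg_zero]
  rw [← intervalIntegral.integral_add_adjacent_intervals (hi _ 0) (hi 0 _), integral_reflect,
    ← intervalIntegral.integral_add (hi_neg _ _) (hi _ _)]
  refine intervalIntegral.intervalIntegral_pos_of_pos_on ((hi_neg _ _).add (hi _ _))
    (fun θ hθ => ?_) (by positivity)
  have hsin : 0 < Real.sin θ :=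
    Real.sin_pos_of_pos_of_lt_pi hθ.1 (by linarith [hθ.2, Real.pi_pos])
  rw [Real.sin_neg]
  nlinarith [hpos θ hθ]

theorem integral_comp_mul_sin_mul_sin_pos {J : Set ℝ} (hJ : Convex ℝ J) {g : ℝ → ℝ}
    (hg : ContinuousOn g J) (hmono : StrictMonoOn g J) {a : ℝ} (ha0 : 0 < a) (ha : a ∈ J)
    (ha' : -a ∈ J) :
    0 < ∫ θ in (-(Real.pi / 2))..(Real.pi / 2), g (a * Real.sin θ) * Real.sin θ := by
  refine integral_mul_sin_pos (continuous_comp_mul_sin hJ hg ha ha') fun θ hθ =>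
    hmono (mul_sin_mem hJ ha ha' _) (mul_sin_mem hJ ha ha' _) ?_
  have hsin : 0 < Real.sin θ :=
    Real.sin_pos_of_pos_of_lt_pi hθ.1 (by linarith [hθ.2, Real.pi_pos])
  rw [Real.sin_neg]
  nlinarith

theorem hasDerivAt_sub_div_add {p m : ℝ → ℝ} {p' m' x : ℝ} (hp : HasDerivAt p p' x)
    (hm : HasDerivAt m m' x) (hne : p x + m x ≠ 0) :
    HasDerivAt (fun x => (p x - m x) / (p x + m x))
      (2 * (p' * m x - p x * m') / (p x + m x) ^ 2) x :=
  ((hp.fun_sub hm).fun_div (hp.fun_add hm) hne).congr_deriv (by ring)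

end Calculus

section Parameter

theorem increasesOn_of_hasDerivAt {f f' : ℝ → ℝ} {s : Set ℝ} (hs : Convex ℝ s)
    (hd : ∀ x ∈ s, HasDerivAt f (f' x) x) (hpos : ∀ x ∈ s, 0 < f' x) : IncreasesOn f s := by
  have hpos' : ∀ x ∈ s, 0 < deriv f x := fun x hx => (hd x hx).deriv ▸ hpos x hx
  exact ⟨strictMonoOn_of_deriv_pos hs (fun x hx => (hd x hx).continuousAt.continuousWithinAt)
    fun x hx => hpos' x (interior_subset hx), fun x hx => ⟨(hd x hx).differentiableAt, hpos' x hx⟩⟩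

theorem IncreasesOn.neg {f : ℝ → ℝ} {s : Set ℝ} (hf : IncreasesOn f s) : DecreasesOn (-f) s :=
  ⟨hf.1.neg, fun x hx => ⟨(hf.2 x hx).1.neg, by simpa using (hf.2 x hx).2⟩⟩

theorem DecreasesOn.neg {f : ℝ → ℝ} {s : Set ℝ} (hf : DecreasesOn f s) : IncreasesOn (-f) s :=
  ⟨hf.1.neg, fun x hx => ⟨(hf.2 x hx).1.neg, by simpa using (hf.2 x hx).2⟩⟩

theorem decreasesOn_of_hasDerivAt {f f' : ℝ → ℝ} {s : Set ℝ} (hs : Convex ℝ s)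
    (hd : ∀ x ∈ s, HasDerivAt f (f' x) x) (hneg : ∀ x ∈ s, f' x < 0) : DecreasesOn f s := by
  simpa using (increasesOn_of_hasDerivAt hs (fun x hx => (hd x hx).neg)
    fun x hx => neg_pos.2 (hneg x hx)).neg

theorem IncreasesOn.comp_invFunOn {e F : ℝ → ℝ} {s : Set ℝ} (hF : IncreasesOn F s)
    (hs : IsOpen s) (he : IncreasesOn e s)
    (hstrict : ∀ x ∈ s, HasStrictDerivAt e (deriv e x) x) :
    IncreasesOn (F ∘ Function.invFunOn e s) (e '' s) := by
  have hinv : LeftInvOn (Function.invFunOn e s) e s := he.1.injOn.leftInvOn_invFunOn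
  refine ⟨?_, ?_⟩
  · rintro _ ⟨x, hx, rfl⟩ _ ⟨y, hy, rfl⟩ hxy
    simpa only [Function.comp, hinv hx, hinv hy] using hF.1 hx hy ((he.1.lt_iff_lt hx hy).1 hxy)
  · rintro _ ⟨x, hx, rfl⟩
    have hinv_deriv : HasDerivAt (Function.invFunOn e s) (deriv e x)⁻¹ (e x) :=
      (hasStrictDerivAt_invFunOn (hs.mem_nhds hx) he.1.injOn (hstrict x hx)
        (he.2 x hx).2.ne').hasDerivAt
    have hcomp : HasDerivAt (F ∘ Function.invFunOn e s) (deriv F x * (deriv e x)⁻¹) (e x) :=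
      HasDerivAt.comp_of_eq (e x) (hF.2 x hx).1.hasDerivAt hinv_deriv (hinv hx).symm
    exact ⟨hcomp.differentiableAt,
      hcomp.deriv ▸ mul_pos (hF.2 x hx).2 (inv_pos.2 (he.2 x hx).2)⟩

theorem DecreasesOn.comp_invFunOn {e F : ℝ → ℝ} {s : Set ℝ} (hF : DecreasesOn F s)
    (hs : IsOpen s) (he : IncreasesOn e s)
    (hstrict : ∀ x ∈ s, HasStrictDerivAt e (deriv e x) x) :
    DecreasesOn (F ∘ Function.invFunOn e s) (e '' s) := by
  simpa [Pi.neg_def, Function.comp_def] using (hF.neg.comp_invFunOn hs he hstrict).neg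

theorem monotoneOn_invFunOn {e : ℝ → ℝ} {s : Set ℝ} (he : StrictMonoOn e s) :
    MonotoneOn (Function.invFunOn e s) (e '' s) := by
  rintro _ ⟨x, hx, rfl⟩ _ ⟨y, hy, rfl⟩ hxy
  simpa only [he.injOn.leftInvOn_invFunOn hx, he.injOn.leftInvOn_invFunOn hy] using
    (he.le_iff_le hx hy).1 hxy

end Parameter

section PotentialWell

/-- A potential well: an analytic potential on an open interval `s` that vanishes at its bottom
`x₀`, decreases to the left and increases to the right of `x₀`, and is nondegenerate there. The
particle of unit mass with this potential oscillates about `x₀`. -/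
structure IsPotentialWell (U : ℝ → ℝ) (s : Set ℝ) (x₀ : ℝ) : Prop where
  isOpen : IsOpen s
  convex : Convex ℝ s
  mem : x₀ ∈ s
  analyticOnNhd : AnalyticOnNhd ℝ U s
  apply_bottom : U x₀ = 0
  deriv_bottom : deriv U x₀ = 0
  sub_mul_deriv_pos : ∀ x ∈ s, x ≠ x₀ → 0 < (x - x₀) * deriv U x
  iteratedDeriv_two_bottom_pos : 0 < iteratedDeriv 2 U x₀

/-- The second-order difference quotient `(U(x) - U(x₀) - U'(x₀)(x - x₀)) / (x - x₀)²`, extended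
analytically to `x = x₀`. -/
def quadraticQuotient (U : ℝ → ℝ) (x₀ : ℝ) : ℝ → ℝ := dslope (dslope U x₀) x₀

/-- The coordinate `y` of a potential well in which the potential is `y²/2`, namely
`y = ±√(2 U(x))` with the sign of `x - x₀`; written so that it is visibly analytic at `x₀`. -/
def wellCoord (U : ℝ → ℝ) (x₀ x : ℝ) : ℝ := (x - x₀) * √(2 * quadraticQuotient U x₀ x)

/-- The range of the coordinate `wellCoord` on the well. -/
def wellRange (U : ℝ → ℝ) (s : Set ℝ) (x₀ : ℝ) : Set ℝ := wellCoord U x₀ '' s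

/-- The inverse of the coordinate `wellCoord`: the position as a function of `y = ±√(2 U)`. -/
def wellInv (U : ℝ → ℝ) (s : Set ℝ) (x₀ : ℝ) : ℝ → ℝ := Function.invFunOn (wellCoord U x₀) s

/-- The half-period of the oscillation of energy `a²/2` in a potential well. -/
def halfPeriod (U : ℝ → ℝ) (s : Set ℝ) (x₀ a : ℝ) : ℝ :=
  ∫ θ in (-(Real.pi / 2))..(Real.pi / 2), deriv (wellInv U s x₀) (a * Real.sin θ)

namespace IsPotentialWell

variable {U : ℝ → ℝ} {s : Set ℝ} {x₀ x y a : ℝ}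

theorem wellInv_mem (hy : y ∈ wellRange U s x₀) : wellInv U s x₀ y ∈ s := Function.invFunOn_mem hy

theorem wellCoord_wellInv (hy : y ∈ wellRange U s x₀) :
    wellCoord U x₀ (wellInv U s x₀ y) = y := Function.invFunOn_eq hy

variable (hw : IsPotentialWell U s x₀)
include hw

theorem hasDerivAt (hx : x ∈ s) : HasDerivAt U (deriv U x) x :=
  (hw.analyticOnNhd x hx).differentiableAt.hasDerivAt

theorem uIcc_subset (hx : x ∈ s) : uIcc x₀ x ⊆ s :=
  hw.convex.ordConnected.uIcc_subset hw.mem hx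

theorem pos (hx : x ∈ s) (hne : x ≠ x₀) : 0 < U x := by
  obtain ⟨ξ, hξ, hslope⟩ := exists_ratio_hasDerivAt_eq_ratio_slope_uIoo hne.symm
    (fun z hz => hw.hasDerivAt (hw.uIcc_subset hx hz)) (fun z _ => hasDerivAt_id z)
  have hξs : ξ ∈ s := hw.uIcc_subset hx (uIoo_subset_uIcc_self hξ)
  have hξx : 0 < (x - x₀) * (ξ - x₀) := by
    rcases hne.lt_or_gt with hlt | hlt
    · rw [uIoo_of_ge hlt.le] at hξ
      nlinarith [hξ.1, hξ.2]
    · rw [uIoo_of_le hlt.le] at hξ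
      nlinarith [hξ.1, hξ.2]
  have h := mul_pos hξx (hw.sub_mul_deriv_pos ξ hξs (by rintro rfl; simp at hξx))
  rw [hw.apply_bottom] at hslope
  simp only [id, sub_zero, mul_one] at hslope
  rw [← hslope]
  exact pos_of_mul_pos_right (a := (ξ - x₀) ^ 2) (by linarith) (sq_nonneg _)

theorem sq_sub_mul_quadraticQuotient (x : ℝ) : (x - x₀) ^ 2 * quadraticQuotient U x₀ x = U x := by
  have h₁ := sub_smul_dslope (dslope U x₀) x₀ x
  have h₂ := sub_smul_dslope_of_zero hw.apply_bottom x
  rw [dslope_same, hw.deriv_bottom, sub_zero] at h₁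
  rw [quadraticQuotient, pow_two, mul_assoc, ← smul_eq_mul (x - x₀) (dslope _ _ _), h₁,
    ← smul_eq_mul, h₂]

theorem analyticOnNhd_quadraticQuotient : AnalyticOnNhd ℝ (quadraticQuotient U x₀) s :=
  analyticOnNhd_dslope (analyticOnNhd_dslope hw.analyticOnNhd hw.mem) hw.mem

theorem two_mul_quadraticQuotient_bottom :
    2 * quadraticQuotient U x₀ x₀ = iteratedDeriv 2 U x₀ := by
  have hq {x : ℝ} (hx : x ∈ s) : HasDerivAt (quadraticQuotient U x₀)
      (deriv (quadraticQuotient U x₀) x) x :=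
    (hw.analyticOnNhd_quadraticQuotient x hx).differentiableAt.hasDerivAt
  have hderiv : deriv U =ᶠ[𝓝 x₀] fun x => 2 * (x - x₀) * quadraticQuotient U x₀ x
      + (x - x₀) ^ 2 * deriv (quadraticQuotient U x₀) x := by
    filter_upwards [hw.isOpen.mem_nhds hw.mem] with x hx
    have h : HasDerivAt (fun x => (x - x₀) ^ 2 * quadraticQuotient U x₀ x) _ x :=
      (((hasDerivAt_id x).sub_const x₀).pow 2).mul (hq hx)
    rw [funext hw.sq_sub_mul_quadraticQuotient] at h
    simpa using h.deriv
  have hderiv₂ : HasDerivAt (fun x => 2 * (x - x₀) * quadraticQuotient U x₀ x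
      + (x - x₀) ^ 2 * deriv (quadraticQuotient U x₀) x) _ x₀ :=
    ((((hasDerivAt_id x₀).sub_const x₀).const_mul 2).mul (hq hw.mem)).add
      ((((hasDerivAt_id x₀).sub_const x₀).pow 2).mul
        (hw.analyticOnNhd_quadraticQuotient x₀ hw.mem).deriv.differentiableAt.hasDerivAt)
  rw [iteratedDeriv_succ, iteratedDeriv_one, hderiv.deriv_eq, hderiv₂.deriv]
  simp

theorem quadraticQuotient_pos (hx : x ∈ s) : 0 < quadraticQuotient U x₀ x := by
  rcases eq_or_ne x x₀ with rfl | hne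
  · linarith [hw.two_mul_quadraticQuotient_bottom, hw.iteratedDeriv_two_bottom_pos]
  · refine pos_of_mul_pos_right ?_ (sq_nonneg (x - x₀))
    exact (hw.sq_sub_mul_quadraticQuotient x).symm ▸ hw.pos hx hne

theorem wellCoord_sq (hx : x ∈ s) : wellCoord U x₀ x ^ 2 = 2 * U x := by
  rw [wellCoord, mul_pow, Real.sq_sqrt (by linarith [hw.quadraticQuotient_pos hx]),
    ← hw.sq_sub_mul_quadraticQuotient x]
  ring

theorem analyticOnNhd_sqrt_quadraticQuotient :
    AnalyticOnNhd ℝ (fun x => √(2 * quadraticQuotient U x₀ x)) s := fun x hx =>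
  ((analyticAt_const.mul (hw.analyticOnNhd_quadraticQuotient x hx)).contDiffAt.sqrt
    (mul_pos two_pos (hw.quadraticQuotient_pos hx)).ne').analyticAt

theorem analyticOnNhd_wellCoord : AnalyticOnNhd ℝ (wellCoord U x₀) s := fun x hx =>
  (analyticAt_id.sub analyticAt_const).mul (hw.analyticOnNhd_sqrt_quadraticQuotient x hx)

theorem wellCoord_mul_deriv (hx : x ∈ s) :
    wellCoord U x₀ x * deriv (wellCoord U x₀) x = deriv U x := by
  have hsq : (fun x => wellCoord U x₀ x ^ 2) =ᶠ[𝓝 x] fun x => 2 * U x := by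
    filter_upwards [hw.isOpen.mem_nhds hx] with x hx using hw.wellCoord_sq hx
  have hY := (hw.analyticOnNhd_wellCoord x hx).differentiableAt.hasDerivAt
  have hsq_deriv := ((hY.pow 2).congr_of_eventuallyEq hsq.symm).unique
    ((hw.hasDerivAt hx).const_mul 2)
  norm_num at hsq_deriv
  linarith

theorem deriv_wellCoord_pos (hx : x ∈ s) : 0 < deriv (wellCoord U x₀) x := by
  have hr : 0 < √(2 * quadraticQuotient U x₀ x) :=
    Real.sqrt_pos.2 (by linarith [hw.quadraticQuotient_pos hx])
  rcases eq_or_ne x x₀ with rfl | hne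
  · have hY := ((hasDerivAt_id x).sub_const x).mul
      (hw.analyticOnNhd_sqrt_quadraticQuotient x hx).differentiableAt.hasDerivAt
    refine hr.trans_eq (Eq.trans ?_ hY.deriv.symm)
    simp
  · have h := hw.sub_mul_deriv_pos x hx hne
    rw [← hw.wellCoord_mul_deriv hx, wellCoord, mul_assoc, ← mul_assoc] at h
    exact pos_of_mul_pos_right (pos_of_mul_pos_right h (mul_self_nonneg _)) hr.le

theorem strictMonoOn_wellCoord : StrictMonoOn (wellCoord U x₀) s :=
  strictMonoOn_of_deriv_pos hw.convex hw.analyticOnNhd_wellCoord.continuousOn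
    fun _ hx => hw.deriv_wellCoord_pos (interior_subset hx)

theorem isOpen_wellRange : IsOpen (wellRange U s x₀) := by
  refine isOpen_iff_mem_nhds.2 ?_
  rintro _ ⟨x, hx, rfl⟩
  rw [← (hw.analyticOnNhd_wellCoord x hx).hasStrictDerivAt.map_nhds_eq
    (hw.deriv_wellCoord_pos hx).ne']
  exact image_mem_map (hw.isOpen.mem_nhds hx)

theorem convex_wellRange : Convex ℝ (wellRange U s x₀) :=
  (hw.convex.isPreconnected.image _ hw.analyticOnNhd_wellCoord.continuousOn).ordConnected.convex

theorem wellInv_wellCoord (hx : x ∈ s) : wellInv U s x₀ (wellCoord U x₀ x) = x :=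
  hw.strictMonoOn_wellCoord.injOn.leftInvOn_invFunOn hx

theorem analyticOnNhd_wellInv : AnalyticOnNhd ℝ (wellInv U s x₀) (wellRange U s x₀) := by
  rintro _ ⟨x, hx, rfl⟩
  exact analyticAt_invFunOn (hw.isOpen.mem_nhds hx) hw.strictMonoOn_wellCoord.injOn
    (hw.analyticOnNhd_wellCoord x hx) (hw.deriv_wellCoord_pos hx).ne'

theorem strictMonoOn_wellInv : StrictMonoOn (wellInv U s x₀) (wellRange U s x₀) := by
  rintro _ ⟨x, hx, rfl⟩ _ ⟨x', hx', rfl⟩ hlt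
  rw [hw.wellInv_wellCoord hx, hw.wellInv_wellCoord hx']
  exact (hw.strictMonoOn_wellCoord.lt_iff_lt hx hx').1 hlt

theorem apply_wellInv (hy : y ∈ wellRange U s x₀) : U (wellInv U s x₀ y) = y ^ 2 / 2 := by
  have h := hw.wellCoord_sq (wellInv_mem hy)
  rw [wellCoord_wellInv hy] at h
  linarith

theorem hasDerivAt_wellInv (hy : y ∈ wellRange U s x₀) :
    HasDerivAt (wellInv U s x₀) (deriv (wellInv U s x₀) y) y :=
  (hw.analyticOnNhd_wellInv y hy).differentiableAt.hasDerivAt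

theorem deriv_mul_deriv_wellInv (hy : y ∈ wellRange U s x₀) :
    deriv U (wellInv U s x₀ y) * deriv (wellInv U s x₀) y = y := by
  have henergy : (fun y => U (wellInv U s x₀ y)) =ᶠ[𝓝 y] fun y => y ^ 2 / 2 := by
    filter_upwards [hw.isOpen_wellRange.mem_nhds hy] with y hy using hw.apply_wellInv hy
  have h := ((HasDerivAt.comp y (hw.hasDerivAt (wellInv_mem hy))
    (hw.hasDerivAt_wellInv hy)).congr_of_eventuallyEq henergy.symm).unique
    ((hasDerivAt_pow 2 y).div_const 2)
  simpa using h

theorem wellInv_ne_bottom (hy : y ∈ wellRange U s x₀) (hy0 : y ≠ 0) : wellInv U s x₀ y ≠ x₀ := by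
  intro h
  have := hw.apply_wellInv hy
  rw [h, hw.apply_bottom] at this
  exact hy0 (by simpa using this.symm)

theorem deriv_ne_zero (hx : x ∈ s) (hne : x ≠ x₀) : deriv U x ≠ 0 :=
  right_ne_zero_of_mul (hw.sub_mul_deriv_pos x hx hne).ne'

end IsPotentialWell

/-- The expression whose sign decides the monotonicity of the period in Chicone's criterion: the
numerator of the second derivative of `U / U'²`. -/
def chiconeExpr (U : ℝ → ℝ) (x : ℝ) : ℝ :=
  6 * U x * iteratedDeriv 2 U x ^ 2 - 3 * deriv U x ^ 2 * iteratedDeriv 2 U x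
    - 2 * U x * deriv U x * iteratedDeriv 3 U x

/-- The coefficient of `U` in `chiconeExpr U`. -/
def schaafDenom (U : ℝ → ℝ) (x : ℝ) : ℝ :=
  6 * iteratedDeriv 2 U x ^ 2 - 2 * deriv U x * iteratedDeriv 3 U x

/-- The expression whose sign decides the monotonicity of the period in Schaaf's criterion. -/
def schaafExpr (U : ℝ → ℝ) (x : ℝ) : ℝ :=
  5 * iteratedDeriv 3 U x ^ 2 - 3 * iteratedDeriv 2 U x * iteratedDeriv 4 U x

theorem hasDerivAt_sub_div_schaafDenom {U : ℝ → ℝ} {x : ℝ} (hU : AnalyticAt ℝ U x)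
    (hD : schaafDenom U x ≠ 0) :
    HasDerivAt (fun x => U x - 3 * deriv U x ^ 2 * iteratedDeriv 2 U x / schaafDenom U x)
      (2 * deriv U x ^ 3 * schaafExpr U x / schaafDenom U x ^ 2) x := by
  have h₀ := hU.differentiableAt.hasDerivAt
  have h₁ : HasDerivAt (deriv U) (iteratedDeriv 2 U x) x := by
    simpa using hasDerivAt_iteratedDeriv_of_analyticAt hU 1
  have h₂ := hasDerivAt_iteratedDeriv_of_analyticAt hU 2
  have h₃ := hasDerivAt_iteratedDeriv_of_analyticAt hU 3
  have hderivD : HasDerivAt (schaafDenom U) _ x :=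
    ((h₂.pow 2).const_mul 6).sub ((h₁.const_mul 2).mul h₃)
  refine (h₀.sub ((((h₁.pow 2).const_mul 3).mul h₂).div hderivD hD)).congr_deriv ?_
  simp only [Pi.mul_apply, Pi.pow_apply]
  field_simp
  simp only [schaafDenom, schaafExpr]
  ring

namespace IsPotentialWell

variable {U : ℝ → ℝ} {s : Set ℝ} {x₀ x y a : ℝ} (hw : IsPotentialWell U s x₀)
include hw

theorem hasDerivAt_deriv (hx : x ∈ s) : HasDerivAt (deriv U) (iteratedDeriv 2 U x) x := by
  simpa using hasDerivAt_iteratedDeriv_of_analyticAt (hw.analyticOnNhd x hx) 1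

theorem hasDerivAt_deriv_wellInv (hy : y ∈ wellRange U s x₀) (hy0 : y ≠ 0) :
    HasDerivAt (deriv (wellInv U s x₀))
      ((deriv U (wellInv U s x₀ y) ^ 2
        - 2 * U (wellInv U s x₀ y) * iteratedDeriv 2 U (wellInv U s x₀ y))
        / deriv U (wellInv U s x₀ y) ^ 3) y := by
  have hf : deriv U (wellInv U s x₀ y) ≠ 0 :=
    hw.deriv_ne_zero (wellInv_mem hy) (hw.wellInv_ne_bottom hy hy0)
  have hcomp : HasDerivAt (fun y => deriv U (wellInv U s x₀ y)) _ y :=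
    HasDerivAt.comp y (hw.hasDerivAt_deriv (wellInv_mem hy)) (hw.hasDerivAt_wellInv hy)
  have hX : deriv (wellInv U s x₀) =ᶠ[𝓝 y] fun y => y / deriv U (wellInv U s x₀ y) := by
    filter_upwards [hw.isOpen_wellRange.mem_nhds hy, hcomp.continuousAt.eventually_ne hf]
      with z hz hfz
    rw [eq_div_iff hfz, mul_comm, hw.deriv_mul_deriv_wellInv hz]
  refine (((hasDerivAt_id y).div hcomp hf).congr_of_eventuallyEq hX).congr_deriv ?_
  have hderiv : deriv (wellInv U s x₀) y = y / deriv U (wellInv U s x₀ y) := by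
    rw [eq_div_iff hf, mul_comm, hw.deriv_mul_deriv_wellInv hy]
  rw [hw.apply_wellInv hy, hderiv, id]
  field_simp

theorem hasDerivAt_deriv_deriv_wellInv (hy : y ∈ wellRange U s x₀) (hy0 : y ≠ 0) :
    HasDerivAt (deriv (deriv (wellInv U s x₀)))
      (chiconeExpr U (wellInv U s x₀ y) / deriv U (wellInv U s x₀ y) ^ 4
        * deriv (wellInv U s x₀) y) y := by
  have hf : deriv U (wellInv U s x₀ y) ≠ 0 :=
    hw.deriv_ne_zero (wellInv_mem hy) (hw.wellInv_ne_bottom hy hy0)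
  have hX : deriv (deriv (wellInv U s x₀)) =ᶠ[𝓝 y] (fun x => (deriv U x ^ 2
      - 2 * U x * iteratedDeriv 2 U x) / deriv U x ^ 3) ∘ wellInv U s x₀ := by
    filter_upwards [hw.isOpen_wellRange.mem_nhds hy, isOpen_ne.mem_nhds hy0] with z hz hz0
    exact (hw.hasDerivAt_deriv_wellInv hz hz0).deriv
  have hx := wellInv_mem hy
  have hquot := (((hw.hasDerivAt_deriv hx).pow 2).sub (((hw.hasDerivAt hx).const_mul 2).mul
    (hasDerivAt_iteratedDeriv_of_analyticAt (hw.analyticOnNhd _ hx) 2))).div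
    ((hw.hasDerivAt_deriv hx).pow 3) (pow_ne_zero 3 hf)
  refine ((HasDerivAt.comp y (hquot.congr_deriv ?_)
    (hw.hasDerivAt_wellInv hy)).congr_of_eventuallyEq hX)
  simp only [chiconeExpr, Pi.sub_apply, Pi.mul_apply, Pi.pow_apply]
  field_simp
  ring

theorem analyticOnNhd_deriv_wellInv :
    AnalyticOnNhd ℝ (deriv (wellInv U s x₀)) (wellRange U s x₀) :=
  hw.analyticOnNhd_wellInv.deriv

theorem deriv_wellInv_pos (hy : y ∈ wellRange U s x₀) : 0 < deriv (wellInv U s x₀) y := by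
  obtain ⟨x, hx, rfl⟩ := hy
  have h := hasStrictDerivAt_invFunOn (hw.isOpen.mem_nhds hx) hw.strictMonoOn_wellCoord.injOn
    (hw.analyticOnNhd_wellCoord x hx).hasStrictDerivAt (hw.deriv_wellCoord_pos hx).ne'
  exact (inv_pos.2 (hw.deriv_wellCoord_pos hx)).trans_eq h.hasDerivAt.deriv.symm

theorem zero_mem_wellRange : (0 : ℝ) ∈ wellRange U s x₀ := ⟨x₀, hw.mem, by simp [wellCoord]⟩

theorem continuousOn_deriv_deriv_wellInv :
    ContinuousOn (deriv (deriv (wellInv U s x₀))) (wellRange U s x₀) :=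
  hw.analyticOnNhd_deriv_wellInv.deriv.continuousOn

theorem strictMonoOn_deriv_deriv_wellInv (hC : ∀ x ∈ s, x ≠ x₀ → 0 < chiconeExpr U x) :
    StrictMonoOn (deriv (deriv (wellInv U s x₀))) (wellRange U s x₀) :=
  strictMonoOn_of_hasDerivAt_pos_of_ne hw.convex_wellRange hw.zero_mem_wellRange
    hw.continuousOn_deriv_deriv_wellInv (fun _ hy hy0 => hw.hasDerivAt_deriv_deriv_wellInv hy hy0)
    fun _ hy hy0 => mul_pos (div_pos (hC _ (wellInv_mem hy) (hw.wellInv_ne_bottom hy hy0))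
      ((even_two_mul 2).pow_pos (hw.deriv_ne_zero (wellInv_mem hy) (hw.wellInv_ne_bottom hy hy0))))
      (hw.deriv_wellInv_pos hy)

theorem strictMonoOn_neg_deriv_deriv_wellInv (hC : ∀ x ∈ s, x ≠ x₀ → chiconeExpr U x < 0) :
    StrictMonoOn (-deriv (deriv (wellInv U s x₀))) (wellRange U s x₀) :=
  strictMonoOn_of_hasDerivAt_pos_of_ne hw.convex_wellRange hw.zero_mem_wellRange
    hw.continuousOn_deriv_deriv_wellInv.neg
    (fun _ hy hy0 => (hw.hasDerivAt_deriv_deriv_wellInv hy hy0).neg)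
    fun _ hy hy0 => neg_pos.2 (mul_neg_of_neg_of_pos
      (div_neg_of_neg_of_pos (hC _ (wellInv_mem hy) (hw.wellInv_ne_bottom hy hy0))
      ((even_two_mul 2).pow_pos (hw.deriv_ne_zero (wellInv_mem hy) (hw.wellInv_ne_bottom hy hy0))))
      (hw.deriv_wellInv_pos hy))

theorem hasDerivAt_halfPeriod (ha : a ∈ wellRange U s x₀) (ha' : -a ∈ wellRange U s x₀) :
    HasDerivAt (halfPeriod U s x₀) (∫ θ in (-(Real.pi / 2))..(Real.pi / 2),
      deriv (deriv (wellInv U s x₀)) (a * Real.sin θ) * Real.sin θ) a :=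
  hasDerivAt_integral_comp_mul_sin hw.convex_wellRange hw.isOpen_wellRange
    (fun y hy => (hw.analyticOnNhd_deriv_wellInv y hy).differentiableAt.hasDerivAt)
    hw.continuousOn_deriv_deriv_wellInv _ _ ha ha'

theorem deriv_halfPeriod_pos (hC : ∀ x ∈ s, x ≠ x₀ → 0 < chiconeExpr U x) (ha0 : 0 < a)
    (ha : a ∈ wellRange U s x₀) (ha' : -a ∈ wellRange U s x₀) :
    0 < deriv (halfPeriod U s x₀) a := by
  rw [(hw.hasDerivAt_halfPeriod ha ha').deriv]
  exact integral_comp_mul_sin_mul_sin_pos hw.convex_wellRange hw.continuousOn_deriv_deriv_wellInv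
    (hw.strictMonoOn_deriv_deriv_wellInv hC) ha0 ha ha'

theorem deriv_halfPeriod_neg (hC : ∀ x ∈ s, x ≠ x₀ → chiconeExpr U x < 0) (ha0 : 0 < a)
    (ha : a ∈ wellRange U s x₀) (ha' : -a ∈ wellRange U s x₀) :
    deriv (halfPeriod U s x₀) a < 0 := by
  rw [(hw.hasDerivAt_halfPeriod ha ha').deriv]
  have h := integral_comp_mul_sin_mul_sin_pos hw.convex_wellRange
    hw.continuousOn_deriv_deriv_wellInv.neg (hw.strictMonoOn_neg_deriv_deriv_wellInv hC) ha0 ha ha'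
  simpa using h

theorem deriv_halfPeriod_eq_zero
    (hC : ∀ x ∈ s, deriv U x ^ 2 = 2 * U x * iteratedDeriv 2 U x) (ha0 : a ≠ 0)
    (ha : a ∈ wellRange U s x₀) (ha' : -a ∈ wellRange U s x₀) :
    deriv (halfPeriod U s x₀) a = 0 := by
  rw [(hw.hasDerivAt_halfPeriod ha ha').deriv]
  refine intervalIntegral.integral_zero_ae (Eventually.of_forall fun θ _ => ?_)
  rcases eq_or_ne (Real.sin θ) 0 with hθ | hθ
  · rw [hθ, mul_zero]
  · have hy := mul_sin_mem hw.convex_wellRange ha ha' θ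
    rw [(hw.hasDerivAt_deriv_wellInv hy (mul_ne_zero ha0 hθ)).deriv, hC _ (wellInv_mem hy),
      sub_self, zero_div, zero_mul]

-- Cauchy's mean value theorem for `U - 3 U'² U'' / schaafDenom U` against `U`, both of which vanish
-- at the bottom.
theorem exists_chiconeExpr_eq_mul_schaafExpr (hx : x ∈ s) (hne : x ≠ x₀)
    (hD : ∀ z ∈ uIcc x₀ x, 0 < schaafDenom U z) :
    ∃ ξ ∈ uIoo x₀ x, ∃ c > 0, chiconeExpr U x = c * schaafExpr U ξ := by
  obtain ⟨ξ, hξ, hratio⟩ := exists_ratio_hasDerivAt_eq_ratio_slope_uIoo hne.symm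
    (fun z hz => hasDerivAt_sub_div_schaafDenom
      (hw.analyticOnNhd z (hw.uIcc_subset hx hz)) (hD z hz).ne')
    (fun z hz => hw.hasDerivAt (hw.uIcc_subset hx hz))
  have hξ' := uIoo_subset_uIcc_self hξ
  have hξ₀ : ξ ≠ x₀ := by
    rintro rfl
    exact left_notMem_uIoo hξ
  have hf : deriv U ξ ≠ 0 := hw.deriv_ne_zero (hw.uIcc_subset hx hξ') hξ₀
  have hDξ := hD ξ hξ'
  have hDx := hD x right_mem_uIcc
  refine ⟨ξ, hξ, schaafDenom U x * U x * (2 * deriv U ξ ^ 2 / schaafDenom U ξ ^ 2),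
    mul_pos (mul_pos hDx (hw.pos hx hne)) (by positivity), ?_⟩
  have hC : chiconeExpr U x = schaafDenom U x *
      (U x - 3 * deriv U x ^ 2 * iteratedDeriv 2 U x / schaafDenom U x) := by
    rw [mul_sub, mul_div_cancel₀ _ hDx.ne', chiconeExpr, schaafDenom]
    ring
  simp only [hw.apply_bottom, hw.deriv_bottom] at hratio
  have hquot : U x - 3 * deriv U x ^ 2 * iteratedDeriv 2 U x / schaafDenom U x
      = U x * (2 * deriv U ξ ^ 2 * schaafExpr U ξ / schaafDenom U ξ ^ 2) := by
    refine mul_right_cancel₀ hf ?_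
    have hsimp : U x * (2 * deriv U ξ ^ 3 * schaafExpr U ξ / schaafDenom U ξ ^ 2)
        = (U x - 3 * deriv U x ^ 2 * iteratedDeriv 2 U x / schaafDenom U x) * deriv U ξ := by
      simpa using hratio
    rw [← hsimp]
    ring
  rw [hC, hquot]
  ring

theorem mem_wellRange (hx : x ∈ s) (hx₀ : x₀ ≤ x) (hy : 0 ≤ y) (hyx : y ^ 2 ≤ 2 * U x) :
    y ∈ wellRange U s x₀ := by
  have hcoord : 0 ≤ wellCoord U x₀ x := mul_nonneg (sub_nonneg.2 hx₀) (Real.sqrt_nonneg _)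
  refine hw.convex_wellRange.ordConnected.out hw.zero_mem_wellRange ⟨x, hx, rfl⟩ ⟨hy, ?_⟩
  rwa [← sq_le_sq₀ hy hcoord, hw.wellCoord_sq hx]

theorem neg_mem_wellRange (hx : x ∈ s) (hx₀ : x ≤ x₀) (hy : 0 ≤ y) (hyx : y ^ 2 ≤ 2 * U x) :
    -y ∈ wellRange U s x₀ := by
  have hcoord : wellCoord U x₀ x ≤ 0 :=
    mul_nonpos_of_nonpos_of_nonneg (sub_nonpos.2 hx₀) (Real.sqrt_nonneg _)
  refine hw.convex_wellRange.ordConnected.out ⟨x, hx, rfl⟩ hw.zero_mem_wellRange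
    ⟨?_, neg_nonpos.2 hy⟩
  rwa [le_neg, ← sq_le_sq₀ hy (neg_nonneg.2 hcoord), neg_sq, hw.wellCoord_sq hx]

theorem lt_bottom_of_apply_eq (hx : x ∈ s) (hy : y ∈ s) (hxy : x < y) (hU : U x = U y) :
    x < x₀ := by
  by_contra! hx₀
  have hcoord : 0 ≤ wellCoord U x₀ x := mul_nonneg (sub_nonneg.2 hx₀) (Real.sqrt_nonneg _)
  have hlt := pow_lt_pow_left₀ (hw.strictMonoOn_wellCoord hx hy hxy) hcoord two_ne_zero
  rw [hw.wellCoord_sq hx, hw.wellCoord_sq hy, hU] at hlt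
  exact hlt.false

theorem wellCoord_eq_iff (hx : x ∈ s) (hy : y ∈ wellRange U s x₀) :
    wellCoord U x₀ x = y ↔ x = wellInv U s x₀ y := by
  constructor
  · rintro rfl
    exact (hw.wellInv_wellCoord hx).symm
  · rintro rfl
    exact wellCoord_wellInv hy

theorem wellCoord_lt_iff (hx : x ∈ s) (hy : y ∈ wellRange U s x₀) :
    wellCoord U x₀ x < y ↔ x < wellInv U s x₀ y := by
  rw [← hw.strictMonoOn_wellCoord.lt_iff_lt hx (wellInv_mem hy), wellCoord_wellInv hy]

theorem lt_wellCoord_iff (hx : x ∈ s) (hy : y ∈ wellRange U s x₀) :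
    y < wellCoord U x₀ x ↔ wellInv U s x₀ y < x := by
  rw [← hw.strictMonoOn_wellCoord.lt_iff_lt (wellInv_mem hy) hx, wellCoord_wellInv hy]

theorem apply_eq_iff (ha : a ∈ wellRange U s x₀) (ha' : -a ∈ wellRange U s x₀) (hx : x ∈ s) :
    U x = a ^ 2 / 2 ↔ x = wellInv U s x₀ a ∨ x = wellInv U s x₀ (-a) := by
  rw [← hw.wellCoord_eq_iff hx ha, ← hw.wellCoord_eq_iff hx ha', ← sq_eq_sq_iff_eq_or_eq_neg,
    hw.wellCoord_sq hx, eq_div_iff two_ne_zero, mul_comm]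

theorem apply_lt_iff (ha0 : 0 < a) (ha : a ∈ wellRange U s x₀) (ha' : -a ∈ wellRange U s x₀)
    (hx : x ∈ s) : U x < a ^ 2 / 2 ↔ x ∈ Ioo (wellInv U s x₀ (-a)) (wellInv U s x₀ a) := by
  rw [mem_Ioo, ← hw.lt_wellCoord_iff hx ha', ← hw.wellCoord_lt_iff hx ha, ← abs_lt,
    ← sq_lt_sq₀ (abs_nonneg _) ha0.le, sq_abs, hw.wellCoord_sq hx, lt_div_iff₀ two_pos, mul_comm]

theorem sqrt_sq_sub_two_mul_wellInv_mul_sin {θ : ℝ} (ha : a * Real.sin θ ∈ wellRange U s x₀)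
    (hcos : 0 ≤ a * Real.cos θ) :
    √(a ^ 2 - 2 * U (wellInv U s x₀ (a * Real.sin θ))) = a * Real.cos θ := by
  rw [hw.apply_wellInv ha, ← Real.sqrt_sq hcos]
  congr 1
  linear_combination -a ^ 2 * Real.sin_sq_add_cos_sq θ

theorem intervalIntegrable_and_integral_one_div_sqrt (ha0 : 0 < a) (ha : a ∈ wellRange U s x₀)
    (ha' : -a ∈ wellRange U s x₀) :
    IntervalIntegrable (fun x => 1 / √(a ^ 2 - 2 * U x)) volume
        (wellInv U s x₀ (-a)) (wellInv U s x₀ a) ∧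
      ∫ x in (wellInv U s x₀ (-a))..(wellInv U s x₀ a), 1 / √(a ^ 2 - 2 * U x)
        = halfPeriod U s x₀ a := by
  have hmem := mul_sin_mem hw.convex_wellRange ha ha'
  have hpi : -(Real.pi / 2) ≤ Real.pi / 2 := by linarith [Real.pi_pos]
  have hcos : ∀ θ ∈ uIoo (-(Real.pi / 2)) (Real.pi / 2), 0 < a * Real.cos θ := fun θ hθ => by
    rw [uIoo_of_le hpi] at hθ
    exact mul_pos ha0 (Real.cos_pos_of_mem_Ioo hθ)
  have hcont := (continuous_comp_mul_sin hw.convex_wellRange hw.analyticOnNhd_wellInv.continuousOn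
    ha ha').continuousOn (s := uIcc (-(Real.pi / 2)) (Real.pi / 2))
  have hderiv := fun θ (_ : θ ∈ uIoo (-(Real.pi / 2)) (Real.pi / 2)) =>
    HasDerivAt.comp θ (hw.hasDerivAt_wellInv (hmem θ)) ((Real.hasDerivAt_sin θ).const_mul a)
  have hderiv_nonneg := fun θ hθ => (mul_pos (hw.deriv_wellInv_pos (hmem θ)) (hcos θ hθ)).le
  have hcancel : EqOn (fun θ => (deriv (wellInv U s x₀) (a * Real.sin θ) * (a * Real.cos θ)) •
      ((fun x => 1 / √(a ^ 2 - 2 * U x)) ∘ (wellInv U s x₀ ∘ fun θ => a * Real.sin θ)) θ)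
      (fun θ => deriv (wellInv U s x₀) (a * Real.sin θ)) (uIoo (-(Real.pi / 2)) (Real.pi / 2)) := by
    intro θ hθ
    simp only [Function.comp_apply, smul_eq_mul,
      hw.sqrt_sq_sub_two_mul_wellInv_mul_sin (hmem θ) (hcos θ hθ).le]
    rw [mul_assoc, mul_one_div_cancel (hcos θ hθ).ne', mul_one]
  have hint := intervalIntegral.integrable_deriv_smul_comp_iff_of_deriv_nonneg hcont hderiv
    hderiv_nonneg (g := fun x => 1 / √(a ^ 2 - 2 * U x))
  have hintegral := intervalIntegral.integral_deriv_smul_comp_of_deriv_nonneg hcont hderiv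
    hderiv_nonneg (g := fun x => 1 / √(a ^ 2 - 2 * U x))
  simp only [Function.comp_apply, Real.sin_neg, Real.sin_pi_div_two, mul_neg, mul_one]
    at hint hintegral
  rw [← hint, ← hintegral]
  exact ⟨(intervalIntegrable_congr_uIoo hcancel).2 ((continuous_comp_mul_sin hw.convex_wellRange
    hw.analyticOnNhd_deriv_wellInv.continuousOn ha ha').intervalIntegrable _ _),
    intervalIntegral.integral_congr_uIoo hcancel⟩

end IsPotentialWell

end PotentialWell

section Oscillator

/-- The potential `x²/2 - x^β/β` of the oscillator to which a suitable power of the inverse radius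
reduces the radial motion. -/
def oscPotential (β x : ℝ) : ℝ := x ^ 2 / 2 - x ^ β / β

/-- The oscillator potential normalized to vanish at its minimum `x = 1`. -/
def oscExcess (β x : ℝ) : ℝ := oscPotential β x - oscPotential β 1

variable {β κ x y : ℝ}

theorem oscPotential_one : oscPotential β 1 = (1 - 2 / β) / 2 := by
  rw [oscPotential, Real.one_rpow]
  ring

theorem analyticAt_oscExcess (hx : 0 < x) : AnalyticAt ℝ (oscExcess β) x :=
  (((analyticAt_id.pow 2).div_const).sub
    ((Real.contDiffAt_rpow_const_of_ne hx.ne').analyticAt.div_const)).sub analyticAt_const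

theorem hasDerivAt_oscExcess (hβ : β ≠ 0) (hx : 0 < x) :
    HasDerivAt (oscExcess β) (x * (1 - x ^ (β - 2))) x := by
  refine ((((hasDerivAt_pow 2 x).div_const 2).sub
    ((Real.hasDerivAt_rpow_const (Or.inl hx.ne')).div_const β)).sub_const _).congr_deriv ?_
  rw [show β - 2 = β - 1 - 1 by ring, Real.rpow_sub_one hx.ne' (β - 1)]
  field_simp
  push_cast
  ring

theorem hasDerivAt_rpow_sub_two (hx : 0 < x) :
    HasDerivAt (fun x : ℝ => x ^ (β - 2)) ((β - 2) * (x ^ (β - 2) / x)) x := by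
  simpa only [Real.rpow_sub_one hx.ne'] using
    Real.hasDerivAt_rpow_const (p := β - 2) (Or.inl hx.ne')

theorem deriv_oscExcess (hβ : β ≠ 0) (hx : 0 < x) :
    deriv (oscExcess β) x = x * (1 - x ^ (β - 2)) :=
  (hasDerivAt_oscExcess hβ hx).deriv

theorem iteratedDeriv_two_oscExcess (hβ : β ≠ 0) (hx : 0 < x) :
    iteratedDeriv 2 (oscExcess β) x = 1 - (β - 1) * x ^ (β - 2) := by
  have hderiv : iteratedDeriv 1 (oscExcess β) =ᶠ[𝓝 x] id * fun x => 1 - x ^ (β - 2) :=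
    (eventually_gt_nhds hx).mono fun y hy => by
      rw [iteratedDeriv_one, deriv_oscExcess hβ hy, Pi.mul_apply, id]
  refine iteratedDeriv_succ_eq_of_hasDerivAt hderiv
    (((hasDerivAt_id x).mul ((hasDerivAt_rpow_sub_two hx).const_sub 1)).congr_deriv ?_)
  simp only [id]
  field_simp
  ring

theorem iteratedDeriv_three_oscExcess (hβ : β ≠ 0) (hx : 0 < x) :
    iteratedDeriv 3 (oscExcess β) x = -((β - 1) * (β - 2)) * (x ^ (β - 2) / x) :=
  iteratedDeriv_succ_eq_of_hasDerivAt
    ((eventually_gt_nhds hx).mono fun _ => iteratedDeriv_two_oscExcess hβ)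
    ((((hasDerivAt_rpow_sub_two hx).const_mul (β - 1)).const_sub 1).congr_deriv (by ring))

theorem iteratedDeriv_four_oscExcess (hβ : β ≠ 0) (hx : 0 < x) :
    iteratedDeriv 4 (oscExcess β) x = -((β - 1) * (β - 2) * (β - 3)) * (x ^ (β - 2) / x ^ 2) := by
  refine iteratedDeriv_succ_eq_of_hasDerivAt
    ((eventually_gt_nhds hx).mono fun _ => iteratedDeriv_three_oscExcess hβ)
    ((((hasDerivAt_rpow_sub_two hx).div (hasDerivAt_id x) hx.ne').const_mul _).congr_deriv ?_)
  simp only [id]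
  field_simp
  ring

theorem schaafDenom_oscExcess (hβ : β ≠ 0) (hx : 0 < x) :
    schaafDenom (oscExcess β) x = 6 * (1 - (β - 1) * x ^ (β - 2)) ^ 2
      + 2 * (β - 1) * (β - 2) * x ^ (β - 2) * (1 - x ^ (β - 2)) := by
  rw [schaafDenom, deriv_oscExcess hβ hx, iteratedDeriv_two_oscExcess hβ hx,
    iteratedDeriv_three_oscExcess hβ hx]
  field_simp
  ring

theorem schaafExpr_oscExcess (hβ : β ≠ 0) (hx : 0 < x) :
    schaafExpr (oscExcess β) x = (β - 1) * (β - 2) * (x ^ (β - 2) / x ^ 2)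
      * (3 * (β - 3) + (β - 1) * (2 * β - 1) * x ^ (β - 2)) := by
  rw [schaafExpr, iteratedDeriv_two_oscExcess hβ hx, iteratedDeriv_three_oscExcess hβ hx,
    iteratedDeriv_four_oscExcess hβ hx]
  field_simp
  ring

theorem isPotentialWell_oscExcess (hβ : β ≠ 0) (hβ2 : β < 2) :
    IsPotentialWell (oscExcess β) (Ioi 0) 1 where
  isOpen := isOpen_Ioi
  convex := convex_Ioi 0
  mem := mem_Ioi.2 one_pos
  analyticOnNhd _ hx := analyticAt_oscExcess hx
  apply_bottom := sub_self _
  deriv_bottom := by simp [deriv_oscExcess hβ one_pos]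
  sub_mul_deriv_pos x hx hne := by
    rw [deriv_oscExcess hβ hx, mul_left_comm]
    refine mul_pos hx ?_
    rcases hne.lt_or_gt with hlt | hgt
    · exact mul_pos_of_neg_of_neg (sub_neg.2 hlt)
        (sub_neg.2 (Real.one_lt_rpow_of_pos_of_lt_one_of_neg hx hlt (by linarith)))
    · exact mul_pos (sub_pos.2 hgt)
        (sub_pos.2 (Real.rpow_lt_one_of_one_lt_of_neg hgt (by linarith)))
  iteratedDeriv_two_bottom_pos := by
    rw [iteratedDeriv_two_oscExcess hβ one_pos, Real.one_rpow]
    linarith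

theorem schaafExpr_oscExcess_pos (hβ1 : 1 < β) (hβ2 : β < 2) (hx : 0 < x)
    (h : 0 < iteratedDeriv 2 (oscExcess β) x) : 0 < schaafExpr (oscExcess β) x := by
  have hβ : β ≠ 0 := by linarith
  rw [iteratedDeriv_two_oscExcess hβ hx] at h
  rw [schaafExpr_oscExcess hβ hx]
  have ht : 0 < x ^ (β - 2) / x ^ 2 := by positivity
  exact mul_pos_of_neg_of_neg (mul_neg_of_neg_of_pos (by nlinarith) ht) (by nlinarith)

theorem schaafExpr_oscExcess_neg (hβ : 1 / 2 < β) (hβ1 : β < 1) (hx : 0 < x) :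
    schaafExpr (oscExcess β) x < 0 := by
  rw [schaafExpr_oscExcess (by linarith) hx]
  have ht : 0 < x ^ (β - 2) / x ^ 2 := by positivity
  have hprod : 0 < (1 - β) * (2 * β - 1) * x ^ (β - 2) :=
    mul_pos (mul_pos (by linarith) (by linarith)) (Real.rpow_pos_of_pos hx _)
  exact mul_neg_of_pos_of_neg (mul_pos (by nlinarith) ht) (by nlinarith)

theorem schaafDenom_oscExcess_pos (hβ1 : 1 < β) (hβ2 : β < 2) (hx : 0 < x)
    (h : 0 < iteratedDeriv 2 (oscExcess β) x) : 0 < schaafDenom (oscExcess β) x := by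
  have hβ : β ≠ 0 := by linarith
  rw [iteratedDeriv_two_oscExcess hβ hx] at h
  rw [schaafDenom_oscExcess hβ hx]
  have ht : 0 < x ^ (β - 2) := Real.rpow_pos_of_pos hx _
  generalize x ^ (β - 2) = t at h ht ⊢
  obtain ⟨p, rfl⟩ : ∃ p, β = p + 1 := ⟨β - 1, by ring⟩
  have hp0 : 0 < p := by linarith
  have hp1 : p < 1 := by linarith
  simp only [add_sub_cancel_right] at h ⊢
  rcases le_or_gt 1 t with ht1 | ht1
  · have := mul_nonneg (mul_pos hp0 ht).le (mul_nonneg (sub_nonneg.2 hp1.le) (sub_nonneg.2 ht1))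
    nlinarith [mul_pos h h]
  · have h₁ : 1 - t ≤ 1 - p * t := by nlinarith
    have h₂ : p * t * (1 - p) ≤ 1 - p * t := by nlinarith
    have := mul_le_mul h₂ h₁ (by linarith) h.le
    nlinarith [mul_pos h h]

theorem schaafDenom_oscExcess_pos_of_le (hβ : 1 / 2 < β) (hβ1 : β < 1) (hx : 0 < x) (hxy : x ≤ y)
    (hD : 0 < schaafDenom (oscExcess β) x) : 0 < schaafDenom (oscExcess β) y := by
  have hβ0 : β ≠ 0 := by linarith
  have hy : 0 < y := hx.trans_le hxy
  have htu : y ^ (β - 2) ≤ x ^ (β - 2) := Real.rpow_le_rpow_of_nonpos hx hxy (by linarith)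
  have hu : 0 < y ^ (β - 2) := Real.rpow_pos_of_pos hy _
  rw [schaafDenom_oscExcess hβ0 hx] at hD
  rw [schaafDenom_oscExcess hβ0 hy]
  generalize x ^ (β - 2) = t, y ^ (β - 2) = u at hD htu hu ⊢
  -- `schaafDenom / t` is decreasing in `t = x ^ (β - 2)`.
  have hcross : t * (6 * (1 - (β - 1) * u) ^ 2 + 2 * (β - 1) * (β - 2) * u * (1 - u))
      = u * (6 * (1 - (β - 1) * t) ^ 2 + 2 * (β - 1) * (β - 2) * t * (1 - t))
        + (t - u) * (6 + 2 * (1 - β) * (2 * β - 1) * (t * u)) := by ring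
  refine pos_of_mul_pos_right (a := t) ?_ (hu.le.trans htu)
  rw [hcross]
  have hcoeff : 0 < 2 * (1 - β) * (2 * β - 1) := mul_pos (by linarith) (by linarith)
  have ht : 0 < t := hu.trans_le htu
  exact add_pos_of_pos_of_nonneg (mul_pos hu hD) (mul_nonneg (sub_nonneg.2 htu) (by positivity))

theorem iteratedDeriv_two_oscExcess_pos_of_le (hβ1 : 1 < β) (hβ2 : β < 2) (hx : 0 < x)
    (hxy : x ≤ y) (h : 0 < iteratedDeriv 2 (oscExcess β) x) :
    0 < iteratedDeriv 2 (oscExcess β) y := by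
  have hβ : β ≠ 0 := by linarith
  rw [iteratedDeriv_two_oscExcess hβ hx] at h
  rw [iteratedDeriv_two_oscExcess hβ (hx.trans_le hxy)]
  have := Real.rpow_le_rpow_of_nonpos hx hxy (by linarith : β - 2 ≤ 0)
  nlinarith

theorem chiconeExpr_oscExcess_pos (hβ1 : 1 < β) (hβ2 : β < 2) (hx : 0 < x) (hne : x ≠ 1) :
    0 < chiconeExpr (oscExcess β) x := by
  have hβ : β ≠ 0 := by linarith
  have hw := isPotentialWell_oscExcess hβ hβ2
  rcases lt_or_ge 0 (iteratedDeriv 2 (oscExcess β) (min 1 x)) with hconv | hconv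
  · have hpos {z : ℝ} (hz : z ∈ uIcc 1 x) : 0 < z ∧ 0 < iteratedDeriv 2 (oscExcess β) z :=
      ⟨(lt_min one_pos hx).trans_le hz.1, iteratedDeriv_two_oscExcess_pos_of_le hβ1 hβ2
        (lt_min one_pos hx) hz.1 hconv⟩
    obtain ⟨ξ, hξ, c, hc, hC⟩ := hw.exists_chiconeExpr_eq_mul_schaafExpr hx hne fun z hz =>
      schaafDenom_oscExcess_pos hβ1 hβ2 (hpos hz).1 (hpos hz).2
    have hξ' := hpos (uIoo_subset_uIcc_self hξ)
    exact hC ▸ mul_pos hc (schaafExpr_oscExcess_pos hβ1 hβ2 hξ'.1 hξ'.2)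
  · have hlt : x < 1 := hne.lt_of_le <| le_of_not_gt fun hgt => by
      rw [min_eq_left hgt.le] at hconv
      exact hconv.not_gt hw.iteratedDeriv_two_bottom_pos
    rw [min_eq_right hlt.le] at hconv
    have hU : 0 < oscExcess β x := hw.pos hx hne
    have hU' : deriv (oscExcess β) x < 0 := by
      nlinarith [hw.sub_mul_deriv_pos x hx hne]
    have hU''' : 0 < iteratedDeriv 3 (oscExcess β) x := by
      rw [iteratedDeriv_three_oscExcess hβ hx]
      exact mul_pos (by nlinarith) (by positivity)
    have := mul_pos hU (mul_pos (neg_pos.2 hU') hU''')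
    have := mul_nonneg hU.le (sq_nonneg (iteratedDeriv 2 (oscExcess β) x))
    have := mul_nonneg (sq_nonneg (deriv (oscExcess β) x)) (neg_nonneg.2 hconv)
    rw [chiconeExpr]
    linarith

theorem chiconeExpr_oscExcess_neg (hβ : 1 / 2 < β) (hβ1 : β < 1) (hx : 0 < x) (hne : x ≠ 1) :
    chiconeExpr (oscExcess β) x < 0 := by
  have hβ0 : β ≠ 0 := by linarith
  have hw := isPotentialWell_oscExcess hβ0 (by linarith)
  rcases lt_or_ge 0 (schaafDenom (oscExcess β) (min 1 x)) with hD | hD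
  · have hpos {z : ℝ} (hz : z ∈ uIcc 1 x) : 0 < z := (lt_min one_pos hx).trans_le hz.1
    obtain ⟨ξ, hξ, c, hc, hC⟩ := hw.exists_chiconeExpr_eq_mul_schaafExpr hx hne fun z hz =>
      schaafDenom_oscExcess_pos_of_le hβ hβ1 (lt_min one_pos hx) hz.1 hD
    exact hC ▸ mul_neg_of_pos_of_neg hc
      (schaafExpr_oscExcess_neg hβ hβ1 (hpos (uIoo_subset_uIcc_self hξ)))
  · have hlt : x < 1 := hne.lt_of_le <| le_of_not_gt fun hgt => by
      rw [min_eq_left hgt.le, schaafDenom, hw.deriv_bottom] at hD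
      nlinarith [hw.iteratedDeriv_two_bottom_pos]
    rw [min_eq_right hlt.le] at hD
    have hU'' : 0 < iteratedDeriv 2 (oscExcess β) x := by
      rw [iteratedDeriv_two_oscExcess hβ0 hx]
      nlinarith [Real.rpow_pos_of_pos hx (β - 2)]
    have hUD := mul_nonneg (hw.pos hx hne).le (neg_nonneg.2 hD)
    have hUU := mul_pos (sq_pos_of_ne_zero (hw.deriv_ne_zero hx hne)) hU''
    rw [schaafDenom] at hUD
    rw [chiconeExpr]
    linarith

theorem deriv_sq_oscExcess_one (hx : 0 < x) :
    deriv (oscExcess 1) x ^ 2 = 2 * oscExcess 1 x * iteratedDeriv 2 (oscExcess 1) x := by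
  rw [deriv_oscExcess one_ne_zero hx, iteratedDeriv_two_oscExcess one_ne_zero hx, oscExcess,
    oscPotential_one, oscPotential, Real.rpow_one, show (1 : ℝ) - 2 = -1 by norm_num,
    Real.rpow_neg_one]
  field_simp
  ring

end Oscillator

section EnergyLevel

variable {β κ s x y : ℝ}

theorem oscPotential_neg (hβ0 : 0 < β) (hβ2 : β < 2) (hx : 0 < x) (hx1 : x < 1) :
    oscPotential β x < 0 := by
  have hpow : x ^ 2 < x ^ β := by
    simpa only [Real.rpow_two] using Real.rpow_lt_rpow_of_exponent_gt hx hx1 hβ2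
  have hdiv : x ^ β / 2 < x ^ β / β :=
    div_lt_div_of_pos_left (Real.rpow_pos_of_pos hx _) hβ0 hβ2
  rw [oscPotential]
  linarith

theorem exists_one_le_oscPotential_eq_zero (hβ0 : 0 < β) (hβ2 : β < 2) :
    ∃ x, 1 ≤ x ∧ oscPotential β x = 0 := by
  have hbase : 1 ≤ 2 / β := (one_le_div hβ0).2 hβ2.le
  have hx : 0 < (2 / β) ^ (1 / (2 - β)) := Real.rpow_pos_of_pos (by positivity) _
  refine ⟨(2 / β) ^ (1 / (2 - β)), Real.one_le_rpow hbase (one_div_nonneg.2 (by linarith)), ?_⟩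
  have hpow : ((2 / β) ^ (1 / (2 - β))) ^ (2 - β) = 2 / β := by
    rw [← Real.rpow_mul (by positivity), one_div_mul_cancel (by linarith), Real.rpow_one]
  rw [Real.rpow_sub hx, Real.rpow_two, div_eq_iff (Real.rpow_pos_of_pos hx _).ne'] at hpow
  rw [oscPotential, hpow]
  ring

theorem tendsto_oscPotential_nhdsGT_zero (hβ0 : 0 < β) :
    Tendsto (oscPotential β) (𝓝[>] 0) (𝓝 0) := by
  have hcont : ContinuousAt (oscPotential β) 0 :=
    ((continuousAt_id.pow 2).div_const 2).sub
      ((Real.continuousAt_rpow_const 0 β (Or.inr hβ0.le)).div_const β)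
  have hzero : oscPotential β 0 = 0 := by
    rw [oscPotential, Real.zero_rpow hβ0.ne']
    ring
  simpa only [hzero] using hcont.tendsto.mono_left nhdsWithin_le_nhds

/-- The amplitude of the oscillation of energy `κ` in the coordinate `wellCoord` of the well
`oscExcess β`, in which the motion is harmonic up to a reparametrization of time. -/
def oscAmplitude (β κ : ℝ) : ℝ := √(2 * (κ - oscPotential β 1))

/-- The larger turning point of the oscillation of energy `κ`. -/
def oscMax (β κ : ℝ) : ℝ := wellInv (oscExcess β) (Ioi 0) 1 (oscAmplitude β κ)

/-- The smaller turning point of the oscillation of energy `κ`. -/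
def oscMin (β κ : ℝ) : ℝ := wellInv (oscExcess β) (Ioi 0) 1 (-oscAmplitude β κ)

/-- Half of the period of the oscillation of energy `κ`. -/
def oscHalfPeriod (β κ : ℝ) : ℝ := halfPeriod (oscExcess β) (Ioi 0) 1 (oscAmplitude β κ)

/-- The eccentricity of the orbit whose inverse radius, raised to the power `s`, performs the
oscillation of energy `κ`. -/
def oscEccentricity (β s κ : ℝ) : ℝ :=
  (oscMax β κ ^ (1 / s) - oscMin β κ ^ (1 / s)) / (oscMax β κ ^ (1 / s) + oscMin β κ ^ (1 / s))

theorem oscAmplitude_pos (hκ : oscPotential β 1 < κ) : 0 < oscAmplitude β κ :=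
  Real.sqrt_pos.2 (by linarith)

theorem oscAmplitude_sq (hκ : oscPotential β 1 < κ) :
    oscAmplitude β κ ^ 2 = 2 * (κ - oscPotential β 1) :=
  Real.sq_sqrt (by linarith)

theorem oscAmplitude_mem_wellRange (hβ0 : 0 < β) (hβ2 : β < 2)
    (hκ : κ ∈ Ioo (oscPotential β 1) 0) :
    oscAmplitude β κ ∈ wellRange (oscExcess β) (Ioi 0) 1 := by
  obtain ⟨x, hx1, hx⟩ := exists_one_le_oscPotential_eq_zero hβ0 hβ2
  refine (isPotentialWell_oscExcess hβ0.ne' hβ2).mem_wellRange (zero_lt_one.trans_le hx1) hx1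
    (oscAmplitude_pos hκ.1).le ?_
  rw [oscAmplitude_sq hκ.1, oscExcess, hx]
  linarith [hκ.2]

theorem neg_oscAmplitude_mem_wellRange (hβ0 : 0 < β) (hβ2 : β < 2)
    (hκ : κ ∈ Ioo (oscPotential β 1) 0) :
    -oscAmplitude β κ ∈ wellRange (oscExcess β) (Ioi 0) 1 := by
  obtain ⟨x, hx, hx0, hx1⟩ :=
    (((tendsto_oscPotential_nhdsGT_zero hβ0).eventually (lt_mem_nhds hκ.2)).and
      (Ioo_mem_nhdsGT zero_lt_one)).exists
  refine (isPotentialWell_oscExcess hβ0.ne' hβ2).neg_mem_wellRange hx0 hx1.le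
    (oscAmplitude_pos hκ.1).le ?_
  rw [oscAmplitude_sq hκ.1, oscExcess]
  linarith

theorem oscMax_pos (hβ0 : 0 < β) (hβ2 : β < 2) (hκ : κ ∈ Ioo (oscPotential β 1) 0) :
    0 < oscMax β κ :=
  IsPotentialWell.wellInv_mem (oscAmplitude_mem_wellRange hβ0 hβ2 hκ)

theorem oscMin_pos (hβ0 : 0 < β) (hβ2 : β < 2) (hκ : κ ∈ Ioo (oscPotential β 1) 0) :
    0 < oscMin β κ :=
  IsPotentialWell.wellInv_mem (neg_oscAmplitude_mem_wellRange hβ0 hβ2 hκ)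

theorem oscMin_lt_oscMax (hβ0 : 0 < β) (hβ2 : β < 2) (hκ : κ ∈ Ioo (oscPotential β 1) 0) :
    oscMin β κ < oscMax β κ :=
  (isPotentialWell_oscExcess hβ0.ne' hβ2).strictMonoOn_wellInv
    (neg_oscAmplitude_mem_wellRange hβ0 hβ2 hκ) (oscAmplitude_mem_wellRange hβ0 hβ2 hκ)
    (neg_lt_self (oscAmplitude_pos hκ.1))

theorem oscPotential_eq_iff (hβ0 : 0 < β) (hβ2 : β < 2) (hκ : κ ∈ Ioo (oscPotential β 1) 0)
    (hx : 0 < x) : oscPotential β x = κ ↔ x = oscMax β κ ∨ x = oscMin β κ := by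
  rw [oscMax, oscMin, ← (isPotentialWell_oscExcess hβ0.ne' hβ2).apply_eq_iff
    (oscAmplitude_mem_wellRange hβ0 hβ2 hκ) (neg_oscAmplitude_mem_wellRange hβ0 hβ2 hκ) hx,
    oscAmplitude_sq hκ.1, mul_div_cancel_left₀ _ two_ne_zero, oscExcess, sub_left_inj]

theorem oscPotential_lt_iff (hβ0 : 0 < β) (hβ2 : β < 2) (hκ : κ ∈ Ioo (oscPotential β 1) 0)
    (hx : 0 < x) : oscPotential β x < κ ↔ x ∈ Ioo (oscMin β κ) (oscMax β κ) := by
  rw [oscMax, oscMin, ← (isPotentialWell_oscExcess hβ0.ne' hβ2).apply_lt_iff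
    (oscAmplitude_pos hκ.1) (oscAmplitude_mem_wellRange hβ0 hβ2 hκ)
    (neg_oscAmplitude_mem_wellRange hβ0 hβ2 hκ) hx, oscAmplitude_sq hκ.1,
    mul_div_cancel_left₀ _ two_ne_zero, oscExcess, sub_lt_sub_iff_right]

theorem mem_Ioo_of_oscPotential_eq (hβ0 : 0 < β) (hβ2 : β < 2) (hx : 0 < x) (hxy : x < y)
    (hκx : oscPotential β x = κ) (hκy : oscPotential β y = κ) : κ ∈ Ioo (oscPotential β 1) 0 := by
  have hw := isPotentialWell_oscExcess hβ0.ne' hβ2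
  have hx1 : x < 1 := hw.lt_bottom_of_apply_eq hx (hx.trans hxy) hxy (by
    rw [oscExcess, oscExcess, hκx, hκy])
  have hpos : 0 < oscExcess β x := hw.pos hx hx1.ne
  rw [oscExcess, hκx] at hpos
  exact ⟨sub_pos.1 hpos, hκx ▸ oscPotential_neg hβ0 hβ2 hx hx1⟩

theorem intervalIntegrable_and_integral_oscHalfPeriod (hβ0 : 0 < β) (hβ2 : β < 2)
    (hκ : κ ∈ Ioo (oscPotential β 1) 0) :
    IntervalIntegrable (fun x => 1 / √(2 * (κ - oscPotential β x))) volume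
        (oscMin β κ) (oscMax β κ) ∧
      ∫ x in (oscMin β κ)..(oscMax β κ), 1 / √(2 * (κ - oscPotential β x)) =
        oscHalfPeriod β κ := by
  have hradicand : ∀ x, oscAmplitude β κ ^ 2 - 2 * oscExcess β x = 2 * (κ - oscPotential β x) :=
    fun x => by
      rw [oscAmplitude_sq hκ.1, oscExcess]
      ring
  simpa only [hradicand, oscMin, oscMax, oscHalfPeriod] using
    (isPotentialWell_oscExcess hβ0.ne' hβ2).intervalIntegrable_and_integral_one_div_sqrt
      (oscAmplitude_pos hκ.1) (oscAmplitude_mem_wellRange hβ0 hβ2 hκ)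
      (neg_oscAmplitude_mem_wellRange hβ0 hβ2 hκ)

theorem hasDerivAt_oscAmplitude (hκ : oscPotential β 1 < κ) :
    HasDerivAt (oscAmplitude β) (1 / oscAmplitude β κ) κ := by
  have hpos : 0 < 2 * (κ - oscPotential β 1) := by linarith
  refine ((((hasDerivAt_id κ).sub_const (oscPotential β 1)).const_mul 2).sqrt
    hpos.ne').congr_deriv ?_
  rw [mul_one, id, ← oscAmplitude, div_mul_cancel_left₀ two_ne_zero, one_div]

theorem analyticAt_oscAmplitude (hκ : oscPotential β 1 < κ) : AnalyticAt ℝ (oscAmplitude β) κ := by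
  have hpos : 0 < 2 * (κ - oscPotential β 1) := by linarith
  exact (Real.contDiffAt_sqrt hpos.ne').analyticAt.comp_of_eq
    (analyticAt_const.mul (analyticAt_id.sub analyticAt_const)) rfl

theorem hasDerivAt_oscMax (hβ0 : 0 < β) (hβ2 : β < 2) (hκ : κ ∈ Ioo (oscPotential β 1) 0) :
    HasDerivAt (oscMax β) (deriv (wellInv (oscExcess β) (Ioi 0) 1) (oscAmplitude β κ) *
      (1 / oscAmplitude β κ)) κ :=
  HasDerivAt.comp κ ((isPotentialWell_oscExcess hβ0.ne' hβ2).hasDerivAt_wellInv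
    (oscAmplitude_mem_wellRange hβ0 hβ2 hκ)) (hasDerivAt_oscAmplitude hκ.1)

theorem hasDerivAt_oscMin (hβ0 : 0 < β) (hβ2 : β < 2) (hκ : κ ∈ Ioo (oscPotential β 1) 0) :
    HasDerivAt (oscMin β) (deriv (wellInv (oscExcess β) (Ioi 0) 1) (-oscAmplitude β κ) *
      -(1 / oscAmplitude β κ)) κ :=
  HasDerivAt.comp κ ((isPotentialWell_oscExcess hβ0.ne' hβ2).hasDerivAt_wellInv
    (neg_oscAmplitude_mem_wellRange hβ0 hβ2 hκ)) (hasDerivAt_oscAmplitude hκ.1).neg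

theorem analyticAt_oscMax (hβ0 : 0 < β) (hβ2 : β < 2) (hκ : κ ∈ Ioo (oscPotential β 1) 0) :
    AnalyticAt ℝ (oscMax β) κ :=
  AnalyticAt.comp ((isPotentialWell_oscExcess hβ0.ne' hβ2).analyticOnNhd_wellInv _
    (oscAmplitude_mem_wellRange hβ0 hβ2 hκ)) (analyticAt_oscAmplitude hκ.1)

theorem analyticAt_oscMin (hβ0 : 0 < β) (hβ2 : β < 2) (hκ : κ ∈ Ioo (oscPotential β 1) 0) :
    AnalyticAt ℝ (oscMin β) κ :=
  AnalyticAt.comp ((isPotentialWell_oscExcess hβ0.ne' hβ2).analyticOnNhd_wellInv _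
    (neg_oscAmplitude_mem_wellRange hβ0 hβ2 hκ)) (analyticAt_oscAmplitude hκ.1).neg

theorem analyticAt_oscEccentricity (hβ0 : 0 < β) (hβ2 : β < 2)
    (hκ : κ ∈ Ioo (oscPotential β 1) 0) : AnalyticAt ℝ (oscEccentricity β s) κ := by
  have hmax := oscMax_pos hβ0 hβ2 hκ
  have hmin := oscMin_pos hβ0 hβ2 hκ
  have hanalytic_max : AnalyticAt ℝ (fun κ => oscMax β κ ^ (1 / s)) κ :=
    (Real.contDiffAt_rpow_const_of_ne hmax.ne').analyticAt.comp (analyticAt_oscMax hβ0 hβ2 hκ)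
  have hanalytic_min : AnalyticAt ℝ (fun κ => oscMin β κ ^ (1 / s)) κ :=
    (Real.contDiffAt_rpow_const_of_ne hmin.ne').analyticAt.comp (analyticAt_oscMin hβ0 hβ2 hκ)
  exact (hanalytic_max.sub hanalytic_min).div (hanalytic_max.add hanalytic_min) (by positivity)

theorem deriv_oscEccentricity_pos (hβ0 : 0 < β) (hβ2 : β < 2) (hs : 0 < s)
    (hκ : κ ∈ Ioo (oscPotential β 1) 0) : 0 < deriv (oscEccentricity β s) κ := by
  have hw := isPotentialWell_oscExcess hβ0.ne' hβ2
  have hmax := oscMax_pos hβ0 hβ2 hκ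
  have hmin := oscMin_pos hβ0 hβ2 hκ
  have hamp := oscAmplitude_pos hκ.1
  have hspeed_max := hw.deriv_wellInv_pos (oscAmplitude_mem_wellRange hβ0 hβ2 hκ)
  have hspeed_min := hw.deriv_wellInv_pos (neg_oscAmplitude_mem_wellRange hβ0 hβ2 hκ)
  have hderiv : HasDerivAt (oscEccentricity β s) _ κ := hasDerivAt_sub_div_add
    ((hasDerivAt_oscMax hβ0 hβ2 hκ).rpow_const (p := 1 / s) (Or.inl hmax.ne'))
    ((hasDerivAt_oscMin hβ0 hβ2 hκ).rpow_const (p := 1 / s) (Or.inl hmin.ne')) (by positivity)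
  rw [hderiv.deriv]
  simp only [mul_neg, neg_mul, sub_neg_eq_add]
  positivity

theorem hasDerivAt_oscHalfPeriod (hβ0 : 0 < β) (hβ2 : β < 2)
    (hκ : κ ∈ Ioo (oscPotential β 1) 0) :
    HasDerivAt (oscHalfPeriod β)
      (deriv (halfPeriod (oscExcess β) (Ioi 0) 1) (oscAmplitude β κ) / oscAmplitude β κ) κ :=
  (HasDerivAt.comp κ ((isPotentialWell_oscExcess hβ0.ne' hβ2).hasDerivAt_halfPeriod
    (oscAmplitude_mem_wellRange hβ0 hβ2 hκ)
    (neg_oscAmplitude_mem_wellRange hβ0 hβ2 hκ)).differentiableAt.hasDerivAt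
    (hasDerivAt_oscAmplitude hκ.1)).congr_deriv (mul_one_div _ _)

theorem deriv_oscHalfPeriod_neg (hβ : 1 / 2 < β) (hβ1 : β < 1)
    (hκ : κ ∈ Ioo (oscPotential β 1) 0) : deriv (oscHalfPeriod β) κ < 0 := by
  have hβ0 : 0 < β := one_half_pos.trans hβ
  have hβ2 : β < 2 := hβ1.trans one_lt_two
  rw [(hasDerivAt_oscHalfPeriod hβ0 hβ2 hκ).deriv]
  exact div_neg_of_neg_of_pos ((isPotentialWell_oscExcess hβ0.ne' hβ2).deriv_halfPeriod_neg
    (fun x => chiconeExpr_oscExcess_neg hβ hβ1) (oscAmplitude_pos hκ.1)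
    (oscAmplitude_mem_wellRange hβ0 hβ2 hκ) (neg_oscAmplitude_mem_wellRange hβ0 hβ2 hκ))
    (oscAmplitude_pos hκ.1)

theorem deriv_oscHalfPeriod_pos (hβ1 : 1 < β) (hβ2 : β < 2)
    (hκ : κ ∈ Ioo (oscPotential β 1) 0) : 0 < deriv (oscHalfPeriod β) κ := by
  have hβ0 : 0 < β := one_pos.trans hβ1
  rw [(hasDerivAt_oscHalfPeriod hβ0 hβ2 hκ).deriv]
  exact div_pos ((isPotentialWell_oscExcess hβ0.ne' hβ2).deriv_halfPeriod_pos
    (fun x => chiconeExpr_oscExcess_pos hβ1 hβ2) (oscAmplitude_pos hκ.1)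
    (oscAmplitude_mem_wellRange hβ0 hβ2 hκ) (neg_oscAmplitude_mem_wellRange hβ0 hβ2 hκ))
    (oscAmplitude_pos hκ.1)

theorem deriv_oscHalfPeriod_one (hκ : κ ∈ Ioo (oscPotential 1 1) 0) :
    deriv (oscHalfPeriod 1) κ = 0 := by
  rw [(hasDerivAt_oscHalfPeriod one_pos one_lt_two hκ).deriv,
    (isPotentialWell_oscExcess one_ne_zero one_lt_two).deriv_halfPeriod_eq_zero
      (fun x => deriv_sq_oscExcess_one) (oscAmplitude_pos hκ.1).ne'
      (oscAmplitude_mem_wellRange one_pos one_lt_two hκ)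
      (neg_oscAmplitude_mem_wellRange one_pos one_lt_two hκ), zero_div]

end EnergyLevel

section NegPowInv

variable {s c x y r : ℝ}

/-- The inverse of the decreasing function `r ↦ c * r ^ (-s)` on the half line `(0, ∞)`. -/
def negPowInv (s c x : ℝ) : ℝ := (c / x) ^ (1 / s)

theorem negPowInv_pos (hc : 0 < c) (hx : 0 < x) : 0 < negPowInv s c x :=
  Real.rpow_pos_of_pos (div_pos hc hx) _

theorem mul_rpow_neg_pos (hc : 0 < c) (hr : 0 < r) : 0 < c * r ^ (-s) :=
  mul_pos hc (Real.rpow_pos_of_pos hr _)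

theorem mul_rpow_neg_eq_iff (hs : s ≠ 0) (hc : 0 < c) (hr : 0 < r) (hx : 0 < x) :
    c * r ^ (-s) = x ↔ r = negPowInv s c x := by
  rw [negPowInv, one_div, Real.eq_rpow_inv hr.le (div_pos hc hx).le hs, Real.rpow_neg hr.le,
    ← div_eq_mul_inv, div_eq_iff (Real.rpow_pos_of_pos hr _).ne', eq_div_iff hx.ne', mul_comm,
    eq_comm]

theorem mul_negPowInv_rpow_neg (hs : s ≠ 0) (hc : 0 < c) (hx : 0 < x) :
    c * negPowInv s c x ^ (-s) = x :=
  (mul_rpow_neg_eq_iff hs hc (negPowInv_pos hc hx) hx).2 rfl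

theorem strictAntiOn_mul_rpow_neg (hs : 0 < s) (hc : 0 < c) :
    StrictAntiOn (fun r : ℝ => c * r ^ (-s)) (Ioi 0) := fun _ hr₁ _ hr₂ h =>
  mul_lt_mul_of_pos_left (Real.strictAntiOn_rpow_Ioi_of_exponent_neg (neg_neg_of_pos hs) hr₁ hr₂ h)
    hc

theorem lt_negPowInv_iff (hs : 0 < s) (hc : 0 < c) (hr : 0 < r) (hx : 0 < x) :
    r < negPowInv s c x ↔ x < c * r ^ (-s) := by
  rw [← (strictAntiOn_mul_rpow_neg hs hc).lt_iff_gt (negPowInv_pos hc hx) hr,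
    mul_negPowInv_rpow_neg hs.ne' hc hx]

theorem negPowInv_lt_iff (hs : 0 < s) (hc : 0 < c) (hr : 0 < r) (hx : 0 < x) :
    negPowInv s c x < r ↔ c * r ^ (-s) < x := by
  rw [← (strictAntiOn_mul_rpow_neg hs hc).lt_iff_gt hr (negPowInv_pos hc hx),
    mul_negPowInv_rpow_neg hs.ne' hc hx]

theorem analyticAt_negPowInv (hc : 0 < c) (hx : 0 < x) : AnalyticAt ℝ (negPowInv s c) x :=
  (Real.contDiffAt_rpow_const_of_ne (div_pos hc hx).ne').analyticAt.comp
    (analyticAt_const.div analyticAt_id hx.ne')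

theorem deriv_negPowInv_neg (hs : 0 < s) (hc : 0 < c) (hx : 0 < x) :
    deriv (negPowInv s c) x < 0 := by
  have hquot : HasDerivAt (fun x => c / x) (c * -(x ^ 2)⁻¹) x := (hasDerivAt_inv hx.ne').const_mul c
  have hderiv : HasDerivAt (negPowInv s c) _ x :=
    hquot.rpow_const (p := 1 / s) (Or.inl (div_pos hc hx).ne')
  rw [hderiv.deriv]
  have hpow := Real.rpow_pos_of_pos (div_pos hc hx) (1 / s - 1)
  exact mul_neg_of_neg_of_pos (mul_neg_of_neg_of_pos
    (mul_neg_of_pos_of_neg hc (neg_neg_of_pos (by positivity))) (one_div_pos.2 hs)) hpow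

theorem hasDerivAt_mul_rpow_neg (hr : 0 < r) :
    HasDerivAt (fun r : ℝ => c * r ^ (-s)) (-(s * (c * r ^ (-s - 1)))) r :=
  ((Real.hasDerivAt_rpow_const (Or.inl hr.ne')).const_mul c).congr_deriv (by ring)

theorem intervalIntegrable_and_integral_comp_mul_rpow_neg {a b : ℝ} (hs : 0 ≤ s) (hc : 0 ≤ c)
    (ha : 0 < a) (hb : 0 < b) (g : ℝ → ℝ) :
    (IntervalIntegrable (fun r => -(s * (c * r ^ (-s - 1))) * g (c * r ^ (-s))) volume a b ↔
      IntervalIntegrable g volume (c * a ^ (-s)) (c * b ^ (-s))) ∧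
      ∫ r in a..b, -(s * (c * r ^ (-s - 1))) * g (c * r ^ (-s)) =
        ∫ x in (c * a ^ (-s))..(c * b ^ (-s)), g x := by
  have hpos : ∀ r ∈ uIcc a b, 0 < r := fun r hr => (lt_min ha hb).trans_le hr.1
  have hcont : ContinuousOn (fun r : ℝ => c * r ^ (-s)) (uIcc a b) := fun r hr =>
    (hasDerivAt_mul_rpow_neg (hpos r hr)).continuousAt.continuousWithinAt
  have hderiv : ∀ r ∈ uIoo a b,
      HasDerivAt (fun r : ℝ => c * r ^ (-s)) (-(s * (c * r ^ (-s - 1)))) r := fun r hr =>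
    hasDerivAt_mul_rpow_neg (hpos r (uIoo_subset_uIcc_self hr))
  have hnonpos : ∀ r ∈ uIoo a b, -(s * (c * r ^ (-s - 1))) ≤ 0 := fun r hr =>
    neg_nonpos.2 (mul_nonneg hs (mul_nonneg hc
      (Real.rpow_nonneg (hpos r (uIoo_subset_uIcc_self hr)).le _)))
  exact ⟨intervalIntegral.integrable_deriv_smul_comp_iff_of_deriv_nonpos hcont hderiv hnonpos,
    intervalIntegral.integral_deriv_smul_comp_of_deriv_nonpos hcont hderiv hnonpos⟩

end NegPowInv

/-- At energy `h` and angular momentum `ℓ`, the substitution `x = c * r ^ (-s)` turns the radial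
motion into the oscillation of energy `κ` in the potential `oscPotential β`. -/
structure ReducesTo (α ℓ h β s c κ : ℝ) : Prop where
  momentum_ne_zero : ℓ ≠ 0
  exponent_pos : 0 < β
  exponent_lt_two : β < 2
  power_pos : 0 < s
  coeff_pos : 0 < c
  sub_eq (r : ℝ) (hr : 0 < r) : h - potential α r - ℓ ^ 2 / (2 * r ^ 2) =
    (ℓ / c) ^ 2 * (r ^ (s - 1)) ^ 2 * (κ - oscPotential β (c * r ^ (-s)))

namespace ReducesTo

variable {α ℓ h β s c κ r : ℝ} (H : ReducesTo α ℓ h β s c κ)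

include H

theorem factor_pos (hr : 0 < r) : 0 < (ℓ / c) ^ 2 * (r ^ (s - 1)) ^ 2 :=
  mul_pos (sq_pos_of_ne_zero (div_ne_zero H.momentum_ne_zero H.coeff_pos.ne'))
    (pow_pos (Real.rpow_pos_of_pos hr _) 2)

theorem mem_apsides_iff : r ∈ apsides α ℓ h ↔ 0 < r ∧ oscPotential β (c * r ^ (-s)) = κ :=
  and_congr_right fun hr => by
    rw [H.sub_eq r hr, mul_eq_zero_iff_left (H.factor_pos hr).ne', sub_eq_zero, eq_comm]

theorem effPotential_lt_iff (hr : 0 < r) :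
    effPotential α ℓ r < h ↔ oscPotential β (c * r ^ (-s)) < κ := by
  rw [effPotential, ← sub_pos, ← sub_sub, H.sub_eq r hr, mul_pos_iff_of_pos_left (H.factor_pos hr),
    sub_pos]

theorem apsides_eq (hκ : κ ∈ Ioo (oscPotential β 1) 0) :
    apsides α ℓ h = {negPowInv s c (oscMax β κ), negPowInv s c (oscMin β κ)} := by
  have hmax := oscMax_pos H.exponent_pos H.exponent_lt_two hκ
  have hmin := oscMin_pos H.exponent_pos H.exponent_lt_two hκ
  have hpair : ∀ r, 0 < r → (oscPotential β (c * r ^ (-s)) = κ ↔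
      r = negPowInv s c (oscMax β κ) ∨ r = negPowInv s c (oscMin β κ)) := fun r hr => by
    rw [oscPotential_eq_iff H.exponent_pos H.exponent_lt_two hκ (mul_rpow_neg_pos H.coeff_pos hr),
      mul_rpow_neg_eq_iff H.power_pos.ne' H.coeff_pos hr hmax,
      mul_rpow_neg_eq_iff H.power_pos.ne' H.coeff_pos hr hmin]
  ext r
  rw [H.mem_apsides_iff, mem_insert_iff, mem_singleton_iff]
  refine ⟨fun hr => (hpair r hr.1).1 hr.2, fun hr => ?_⟩
  have hr0 : 0 < r := by
    rcases hr with rfl | rfl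
    exacts [negPowInv_pos H.coeff_pos hmax, negPowInv_pos H.coeff_pos hmin]
  exact ⟨hr0, (hpair r hr0).2 hr⟩

theorem negPowInv_oscMax_lt (hκ : κ ∈ Ioo (oscPotential β 1) 0) :
    negPowInv s c (oscMax β κ) < negPowInv s c (oscMin β κ) := by
  have hmax := oscMax_pos H.exponent_pos H.exponent_lt_two hκ
  rw [lt_negPowInv_iff H.power_pos H.coeff_pos (negPowInv_pos H.coeff_pos hmax)
    (oscMin_pos H.exponent_pos H.exponent_lt_two hκ),
    mul_negPowInv_rpow_neg H.power_pos.ne' H.coeff_pos hmax]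
  exact oscMin_lt_oscMax H.exponent_pos H.exponent_lt_two hκ

theorem rMinus_eq (hκ : κ ∈ Ioo (oscPotential β 1) 0) :
    rMinus α ℓ h = negPowInv s c (oscMax β κ) := by
  rw [rMinus, H.apsides_eq hκ, csInf_pair, inf_eq_left]
  exact (H.negPowInv_oscMax_lt hκ).le

theorem rPlus_eq (hκ : κ ∈ Ioo (oscPotential β 1) 0) :
    rPlus α ℓ h = negPowInv s c (oscMin β κ) := by
  rw [rPlus, H.apsides_eq hκ, csSup_pair, sup_eq_right]
  exact (H.negPowInv_oscMax_lt hκ).le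

theorem mem_energies_iff : h ∈ energies α ℓ ↔ κ ∈ Ioo (oscPotential β 1) 0 := by
  constructor
  · rintro ⟨r₁, hr₁, r₂, hr₂, hlt, -⟩
    rw [H.mem_apsides_iff] at hr₁ hr₂
    exact mem_Ioo_of_oscPotential_eq H.exponent_pos H.exponent_lt_two
      (mul_rpow_neg_pos H.coeff_pos hr₂.1)
      (strictAntiOn_mul_rpow_neg H.power_pos H.coeff_pos hr₁.1 hr₂.1 hlt) hr₂.2 hr₁.2
  · intro hκ
    have hmax := oscMax_pos H.exponent_pos H.exponent_lt_two hκ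
    have hmin := oscMin_pos H.exponent_pos H.exponent_lt_two hκ
    refine ⟨_, H.apsides_eq hκ ▸ Or.inl rfl, _, H.apsides_eq hκ ▸ Or.inr rfl,
      H.negPowInv_oscMax_lt hκ, fun r hr => ?_⟩
    have hr0 : 0 < r := (negPowInv_pos H.coeff_pos hmax).trans hr.1
    rw [H.effPotential_lt_iff hr0, oscPotential_lt_iff H.exponent_pos H.exponent_lt_two hκ
      (mul_rpow_neg_pos H.coeff_pos hr0)]
    exact ⟨(lt_negPowInv_iff H.power_pos H.coeff_pos hr0 hmin).1 hr.2,
      (negPowInv_lt_iff H.power_pos H.coeff_pos hr0 hmax).1 hr.1⟩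

theorem eccentricity_eq (hκ : κ ∈ Ioo (oscPotential β 1) 0) :
    eccentricity α ℓ h = oscEccentricity β s κ := by
  have hmax := oscMax_pos H.exponent_pos H.exponent_lt_two hκ
  have hmin := oscMin_pos H.exponent_pos H.exponent_lt_two hκ
  have hc := H.coeff_pos
  rw [eccentricity, H.rMinus_eq hκ, H.rPlus_eq hκ, oscEccentricity, negPowInv, negPowInv,
    Real.div_rpow hc.le hmax.le, Real.div_rpow hc.le hmin.le]
  field_simp [(Real.rpow_pos_of_pos hmax (1 / s)).ne', (Real.rpow_pos_of_pos hmin (1 / s)).ne',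
    (Real.rpow_pos_of_pos hc (1 / s)).ne']

theorem integrand_eq (hr : 0 < r) : integrand α ℓ h r =
    -(1 / s) * (-(s * (c * r ^ (-s - 1))) * (1 / √(2 * (κ - oscPotential β (c * r ^ (-s)))))) := by
  have hℓ : 0 < |ℓ| := abs_pos.2 H.momentum_ne_zero
  have hc := H.coeff_pos
  have hs := H.power_pos
  have hpow : 0 < r ^ (s - 1) := Real.rpow_pos_of_pos hr _
  have hradicand : 2 * (h - potential α r) - ℓ ^ 2 / r ^ 2 =
      (|ℓ| / c * r ^ (s - 1)) ^ 2 * (2 * (κ - oscPotential β (c * r ^ (-s)))) := by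
    have hhalf : ℓ ^ 2 / r ^ 2 = 2 * (ℓ ^ 2 / (2 * r ^ 2)) := by field_simp
    rw [hhalf, ← mul_sub, H.sub_eq r hr, mul_pow, div_pow, div_pow, sq_abs]
    ring
  have hcancel : r ^ (-s - 1) * (r ^ 2 * r ^ (s - 1)) = 1 := by
    rw [← Real.rpow_two, ← Real.rpow_add hr, ← Real.rpow_add hr,
      show -s - 1 + (2 + (s - 1)) = 0 by ring, Real.rpow_zero]
  rw [integrand, hradicand, Real.sqrt_mul (sq_nonneg _), Real.sqrt_sq (by positivity)]
  rw [← eq_div_iff (by positivity)] at hcancel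
  rw [hcancel]
  field_simp [hpow.ne']

theorem intervalIntegrable_and_apsidalAngle_eq (hκ : κ ∈ Ioo (oscPotential β 1) 0) :
    IntervalIntegrable (integrand α ℓ h) volume (rMinus α ℓ h) (rPlus α ℓ h) ∧
      apsidalAngle α ℓ h = 1 / s * oscHalfPeriod β κ := by
  have hmax := oscMax_pos H.exponent_pos H.exponent_lt_two hκ
  have hmin := oscMin_pos H.exponent_pos H.exponent_lt_two hκ
  obtain ⟨hint, hval⟩ :=
    intervalIntegrable_and_integral_oscHalfPeriod H.exponent_pos H.exponent_lt_two hκ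
  rw [apsidalAngle, H.rMinus_eq hκ, H.rPlus_eq hκ]
  have hinner := negPowInv_pos (s := s) H.coeff_pos hmax
  have houter := negPowInv_pos (s := s) H.coeff_pos hmin
  have hintegrand : EqOn (integrand α ℓ h) _
      (uIoo (negPowInv s c (oscMax β κ)) (negPowInv s c (oscMin β κ))) :=
    fun r hr => H.integrand_eq ((lt_min hinner houter).trans hr.1)
  obtain ⟨hint_iff, hsubst⟩ := intervalIntegrable_and_integral_comp_mul_rpow_neg H.power_pos.le
    H.coeff_pos.le hinner houter fun x => 1 / √(2 * (κ - oscPotential β x))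
  rw [mul_negPowInv_rpow_neg H.power_pos.ne' H.coeff_pos hmax,
    mul_negPowInv_rpow_neg H.power_pos.ne' H.coeff_pos hmin] at hint_iff hsubst
  constructor
  · exact (intervalIntegrable_congr_uIoo hintegrand).2 ((hint_iff.2 hint.symm).const_mul _)
  · rw [intervalIntegral.integral_congr_uIoo hintegrand, intervalIntegral.integral_const_mul,
      hsubst, intervalIntegral.integral_symm, hval, neg_mul_neg]

end ReducesTo

/-- Throughout the interval of energies the radial motion reduces to the oscillator with exponent
`β`, whose energy `κ h` is an analytic function of `h` with positive derivative. -/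
structure IsOscReduction (α ℓ β s : ℝ) (c κ : ℝ → ℝ) : Prop where
  isOpen_energies : IsOpen (energies α ℓ)
  convex_energies : Convex ℝ (energies α ℓ)
  reducesTo (h : ℝ) (hh : h ∈ energies α ℓ) : ReducesTo α ℓ h β s (c h) (κ h)
  analyticOnNhd : AnalyticOnNhd ℝ κ (energies α ℓ)
  deriv_pos (h : ℝ) (hh : h ∈ energies α ℓ) : 0 < deriv κ h

namespace IsOscReduction

variable {α ℓ β s h : ℝ} {c κ : ℝ → ℝ} (H : IsOscReduction α ℓ β s c κ)

include H

theorem mem_Ioo (hh : h ∈ energies α ℓ) : κ h ∈ Ioo (oscPotential β 1) 0 :=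
  (H.reducesTo h hh).mem_energies_iff.1 hh

theorem hasDerivAt (hh : h ∈ energies α ℓ) : HasDerivAt κ (deriv κ h) h :=
  (H.analyticOnNhd h hh).differentiableAt.hasDerivAt

theorem eccentricity_eventuallyEq (hh : h ∈ energies α ℓ) :
    eccentricity α ℓ =ᶠ[𝓝 h] oscEccentricity β s ∘ κ := by
  filter_upwards [H.isOpen_energies.mem_nhds hh] with y hy
  exact (H.reducesTo y hy).eccentricity_eq (H.mem_Ioo hy)

theorem apsidalAngle_eventuallyEq (hh : h ∈ energies α ℓ) :
    apsidalAngle α ℓ =ᶠ[𝓝 h] fun h => 1 / s * oscHalfPeriod β (κ h) := by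
  filter_upwards [H.isOpen_energies.mem_nhds hh] with y hy
  exact ((H.reducesTo y hy).intervalIntegrable_and_apsidalAngle_eq (H.mem_Ioo hy)).2

theorem intervalIntegrable_integrand (hh : h ∈ energies α ℓ) :
    IntervalIntegrable (integrand α ℓ h) volume (rMinus α ℓ h) (rPlus α ℓ h) :=
  ((H.reducesTo h hh).intervalIntegrable_and_apsidalAngle_eq (H.mem_Ioo hh)).1

theorem hasStrictDerivAt_eccentricity (hh : h ∈ energies α ℓ) :
    HasStrictDerivAt (eccentricity α ℓ) (deriv (eccentricity α ℓ) h) h :=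
  (((analyticAt_oscEccentricity (H.reducesTo h hh).exponent_pos (H.reducesTo h hh).exponent_lt_two
    (H.mem_Ioo hh)).comp (H.analyticOnNhd h hh)).congr
      (H.eccentricity_eventuallyEq hh).symm).hasStrictDerivAt

theorem increasesOn_eccentricity : IncreasesOn (eccentricity α ℓ) (energies α ℓ) := by
  refine increasesOn_of_hasDerivAt
    (f' := fun h => deriv (oscEccentricity β s) (κ h) * deriv κ h) H.convex_energies
    (fun h hh => ?_) fun h hh => ?_
  · have hβ0 := (H.reducesTo h hh).exponent_pos
    have hβ2 := (H.reducesTo h hh).exponent_lt_two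
    exact (HasDerivAt.comp h (analyticAt_oscEccentricity hβ0 hβ2
      (H.mem_Ioo hh)).differentiableAt.hasDerivAt (H.hasDerivAt hh)).congr_of_eventuallyEq
        (H.eccentricity_eventuallyEq hh)
  · have hred := H.reducesTo h hh
    exact mul_pos (deriv_oscEccentricity_pos hred.exponent_pos hred.exponent_lt_two
      hred.power_pos (H.mem_Ioo hh)) (H.deriv_pos h hh)

theorem hasDerivAt_apsidalAngle (hh : h ∈ energies α ℓ) :
    HasDerivAt (apsidalAngle α ℓ) (1 / s * (deriv (oscHalfPeriod β) (κ h) * deriv κ h)) h :=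
  ((HasDerivAt.comp h (hasDerivAt_oscHalfPeriod (H.reducesTo h hh).exponent_pos
    (H.reducesTo h hh).exponent_lt_two (H.mem_Ioo hh)).differentiableAt.hasDerivAt
    (H.hasDerivAt hh)).const_mul (1 / s)).congr_of_eventuallyEq (H.apsidalAngle_eventuallyEq hh)

theorem decreasesOn_apsidalAngle (hβ : 1 / 2 < β) (hβ1 : β < 1) :
    DecreasesOn (apsidalAngle α ℓ) (energies α ℓ) :=
  decreasesOn_of_hasDerivAt H.convex_energies (fun _ hh => H.hasDerivAt_apsidalAngle hh)
    fun h hh => mul_neg_of_pos_of_neg (one_div_pos.2 (H.reducesTo h hh).power_pos)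
      (mul_neg_of_neg_of_pos (deriv_oscHalfPeriod_neg hβ hβ1 (H.mem_Ioo hh)) (H.deriv_pos h hh))

theorem increasesOn_apsidalAngle (hβ1 : 1 < β) (hβ2 : β < 2) :
    IncreasesOn (apsidalAngle α ℓ) (energies α ℓ) :=
  increasesOn_of_hasDerivAt H.convex_energies (fun _ hh => H.hasDerivAt_apsidalAngle hh)
    fun h hh => mul_pos (one_div_pos.2 (H.reducesTo h hh).power_pos)
      (mul_pos (deriv_oscHalfPeriod_pos hβ1 hβ2 (H.mem_Ioo hh)) (H.deriv_pos h hh))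

theorem monotoneOn_apsidalAngle (hβ : β = 1) :
    MonotoneOn (apsidalAngle α ℓ) (energies α ℓ) := by
  subst hβ
  have hderiv : ∀ h ∈ energies α ℓ, HasDerivAt (apsidalAngle α ℓ) 0 h := fun h hh => by
    simpa only [deriv_oscHalfPeriod_one (H.mem_Ioo hh), zero_mul, mul_zero] using
      H.hasDerivAt_apsidalAngle hh
  exact monotoneOn_of_deriv_nonneg H.convex_energies
    (fun h hh => (hderiv h hh).continuousAt.continuousWithinAt)
    (fun h hh => (hderiv h (interior_subset hh)).differentiableAt.differentiableWithinAt)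
    fun h hh => (hderiv h (interior_subset hh)).deriv.ge

theorem monotoneOn_or_antitoneOn_apsidalAngle (hβ : 1 / 2 < β) (hβ2 : β < 2) :
    MonotoneOn (apsidalAngle α ℓ) (energies α ℓ) ∨
      AntitoneOn (apsidalAngle α ℓ) (energies α ℓ) := by
  rcases lt_trichotomy β 1 with hβ1 | rfl | hβ1
  · exact Or.inr (H.decreasesOn_apsidalAngle hβ hβ1).1.antitoneOn
  · exact Or.inl (H.monotoneOn_apsidalAngle rfl)
  · exact Or.inl (H.increasesOn_apsidalAngle hβ1 hβ2).1.monotoneOn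

end IsOscReduction

section Duality

variable {α ℓ h c : ℝ}

/-- The exponent `2α/(α-2)` dual to `α`. It is the exponent of the oscillator for `α < 0`, and
also the exponent of `ℓ` in the energy of the circular orbit. -/
def dualExponent (α : ℝ) : ℝ := 2 * α / (α - 2)

theorem dualExponent_pos (hα : α < 0) : 0 < dualExponent α :=
  div_pos_of_neg_of_neg (by linarith) (by linarith)

theorem dualExponent_lt_two (hα : α < 0) : dualExponent α < 2 := by
  rw [dualExponent, div_lt_iff_of_neg (by linarith)]
  linarith

theorem half_lt_dualExponent (hα : α < -2 / 3) : 1 / 2 < dualExponent α := by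
  rw [dualExponent, lt_div_iff_of_neg (by linarith)]
  linarith

theorem dualExponent_lt_one (hα : α ∈ Ioo (-2) 0) : dualExponent α < 1 := by
  rw [dualExponent, div_lt_iff_of_neg (by linarith [hα.2])]
  linarith [hα.1]

theorem one_lt_dualExponent (hα : α < -2) : 1 < dualExponent α := by
  rw [dualExponent, lt_div_iff_of_neg (by linarith)]
  linarith

theorem reducesTo_of_pos (hℓ : ℓ ≠ 0) (hα0 : 0 < α) (hα2 : α < 2) (hc : 0 < c)
    (hcα : ℓ ^ 2 * c ^ α = c ^ 2) (h : ℝ) : ReducesTo α ℓ h α 1 c (h * c ^ α) := by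
  refine ⟨hℓ, hα0, hα2, one_pos, hc, fun r hr => ?_⟩
  have hsq : (c * r ^ (-1 : ℝ)) ^ 2 = c ^ 2 / r ^ 2 := by
    rw [Real.rpow_neg_one, ← div_eq_mul_inv, div_pow]
  have hpow : (c * r ^ (-1 : ℝ)) ^ α = c ^ α * r ^ (-α) := by
    rw [Real.mul_rpow hc.le (Real.rpow_nonneg hr.le _), ← Real.rpow_mul hr.le, neg_one_mul]
  rw [oscPotential, hsq, hpow, sub_self, Real.rpow_zero, potential, div_pow]
  have hcα' : c ^ α = c ^ 2 / ℓ ^ 2 := eq_div_of_mul_eq (by positivity) (by rw [← hcα, mul_comm])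
  rw [hcα']
  field_simp
  ring

theorem reducesTo_of_neg (hℓ : ℓ ≠ 0) (hα : α < 0) (hc : 0 < c)
    (hch : ℓ ^ 2 * c ^ dualExponent α = c ^ 2 * (dualExponent α * h)) :
    ReducesTo α ℓ h (dualExponent α) ((2 - α) / 2) c (c ^ 2 / (α * ℓ ^ 2)) := by
  refine ⟨hℓ, dualExponent_pos hα, dualExponent_lt_two hα, by linarith, hc, fun r hr => ?_⟩
  have hα2 : α - 2 ≠ 0 := by linarith
  have hfactor : (r ^ ((2 - α) / 2 - 1)) ^ 2 = r ^ (-α) := by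
    rw [← Real.rpow_mul_natCast hr.le]
    congr 1
    push_cast
    ring
  have hsq : (c * r ^ (-((2 - α) / 2))) ^ 2 = c ^ 2 * (r ^ α / r ^ 2) := by
    rw [mul_pow, ← Real.rpow_mul_natCast hr.le, ← Real.rpow_two r, ← Real.rpow_sub hr]
    congr 2
    push_cast
    ring
  have hpow : (c * r ^ (-((2 - α) / 2))) ^ dualExponent α = c ^ dualExponent α * r ^ α := by
    rw [Real.mul_rpow hc.le (Real.rpow_nonneg hr.le _), ← Real.rpow_mul hr.le]
    congr 2
    rw [dualExponent]
    field_simp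
    ring
  have hcβ : c ^ dualExponent α = c ^ 2 * (dualExponent α * h) / ℓ ^ 2 :=
    eq_div_of_mul_eq (by positivity) (by rw [← hch, mul_comm])
  have hrα : 0 < r ^ α := Real.rpow_pos_of_pos hr _
  have hβ := (dualExponent_pos hα).ne'
  rw [hfactor, oscPotential, hsq, hpow, potential, div_pow, Real.rpow_neg hr.le, hcβ]
  field_simp [hrα.ne']
  ring

theorem oscPotential_dualExponent_one (hα : α < 0) : oscPotential (dualExponent α) 1 = 1 / α := by
  have hα0 : α ≠ 0 := hα.ne
  have hα2 : α - 2 ≠ 0 := by linarith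
  rw [oscPotential_one, dualExponent]
  field_simp [hα2]
  ring

/-- The scale factor in the substitution `x = c * r ^ (-s)` for `0 < α < 2`. -/
def posScale (α ℓ : ℝ) : ℝ := |ℓ| ^ (2 / (2 - α))

theorem posScale_pos (hℓ : ℓ ≠ 0) : 0 < posScale α ℓ :=
  Real.rpow_pos_of_pos (abs_pos.2 hℓ) _

theorem posScale_rpow : posScale α ℓ ^ α = (|ℓ| ^ (2 * α / (α - 2)))⁻¹ := by
  rw [posScale, ← Real.rpow_mul (abs_nonneg ℓ), ← Real.rpow_neg (abs_nonneg ℓ),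
    div_mul_eq_mul_div, ← div_neg, neg_sub]

theorem sq_mul_posScale_rpow (hℓ : ℓ ≠ 0) (hα : α < 2) :
    ℓ ^ 2 * posScale α ℓ ^ α = posScale α ℓ ^ 2 := by
  have hexp : 2 + 2 / (2 - α) * α = 2 / (2 - α) * 2 := by
    have hα2 : 2 - α ≠ 0 := by linarith
    field_simp
    ring
  rw [← sq_abs, ← Real.rpow_two, ← Real.rpow_two, posScale, ← Real.rpow_mul (abs_nonneg ℓ),
    ← Real.rpow_mul (abs_nonneg ℓ), ← Real.rpow_add (abs_pos.2 hℓ), hexp]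

theorem energies_eq_of_pos (hℓ : ℓ ≠ 0) (hα0 : 0 < α) (hα2 : α < 2) :
    energies α ℓ = Ioo ((α - 2) / (2 * α) * |ℓ| ^ (2 * α / (α - 2))) 0 := by
  ext h
  have hL : 0 < |ℓ| ^ (2 * α / (α - 2)) := Real.rpow_pos_of_pos (abs_pos.2 hℓ) _
  have hmin : oscPotential α 1 = (α - 2) / (2 * α) := by
    rw [oscPotential_one]
    field_simp
  rw [(reducesTo_of_pos hℓ hα0 hα2 (posScale_pos hℓ)
    (sq_mul_posScale_rpow hℓ hα2) h).mem_energies_iff, posScale_rpow, ← div_eq_mul_inv, mem_Ioo,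
    mem_Ioo, lt_div_iff₀ hL, div_lt_iff₀ hL, zero_mul, hmin]

theorem isOscReduction_of_pos (hℓ : ℓ ≠ 0) (hα0 : 0 < α) (hα2 : α < 2) :
    IsOscReduction α ℓ α 1 (fun _ => posScale α ℓ) fun h => h * posScale α ℓ ^ α where
  isOpen_energies := energies_eq_of_pos hℓ hα0 hα2 ▸ isOpen_Ioo
  convex_energies := energies_eq_of_pos hℓ hα0 hα2 ▸ convex_Ioo _ _
  reducesTo h _ := reducesTo_of_pos hℓ hα0 hα2 (posScale_pos hℓ) (sq_mul_posScale_rpow hℓ hα2) h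
  analyticOnNhd _ _ := analyticAt_id.mul analyticAt_const
  deriv_pos h _ := by
    rw [(hasDerivAt_mul_const (posScale α ℓ ^ α)).deriv]
    exact Real.rpow_pos_of_pos (posScale_pos hℓ) _

/-- The scale factor in the substitution `x = c * r ^ (-s)` at energy `h` for `α < 0`. -/
def negScale (α ℓ h : ℝ) : ℝ := negPowInv (2 - dualExponent α) (ℓ ^ 2 / dualExponent α) h

theorem sq_div_dualExponent_pos (hℓ : ℓ ≠ 0) (hα : α < 0) : 0 < ℓ ^ 2 / dualExponent α :=
  div_pos (by positivity) (dualExponent_pos hα)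

theorem negScale_pos (hℓ : ℓ ≠ 0) (hα : α < 0) (hh : 0 < h) : 0 < negScale α ℓ h :=
  negPowInv_pos (sq_div_dualExponent_pos hℓ hα) hh

theorem sq_mul_negScale_rpow (hℓ : ℓ ≠ 0) (hα : α < 0) (hh : 0 < h) :
    ℓ ^ 2 * negScale α ℓ h ^ dualExponent α = negScale α ℓ h ^ 2 * (dualExponent α * h) := by
  have hβ := (dualExponent_pos hα).ne'
  have hc := negScale_pos hℓ hα hh
  have hinv : ℓ ^ 2 / dualExponent α * negScale α ℓ h ^ (-(2 - dualExponent α)) = h :=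
    mul_negPowInv_rpow_neg (by linarith [dualExponent_lt_two hα]) (sq_div_dualExponent_pos hℓ hα) hh
  rw [neg_sub, Real.rpow_sub hc, Real.rpow_two] at hinv
  field_simp at hinv
  linarith

theorem negScale_lt_abs_iff (hℓ : ℓ ≠ 0) (hα : α < 0) (hh : 0 < h) :
    negScale α ℓ h < |ℓ| ↔ (α - 2) / (2 * α) * |ℓ| ^ (2 * α / (α - 2)) < h := by
  have hl : 0 < |ℓ| := abs_pos.2 hℓ
  have hbound : ℓ ^ 2 / dualExponent α * |ℓ| ^ (-(2 - dualExponent α)) =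
      (α - 2) / (2 * α) * |ℓ| ^ (2 * α / (α - 2)) := by
    rw [neg_sub, Real.rpow_sub hl, Real.rpow_two, sq_abs, ← dualExponent, ← inv_div (2 * α),
      ← dualExponent]
    field_simp
  rw [negScale, negPowInv_lt_iff (by linarith [dualExponent_lt_two hα])
    (sq_div_dualExponent_pos hℓ hα) hl hh, hbound]

theorem pos_of_mem_energies (hα : α < 0) (hh : h ∈ energies α ℓ) : 0 < h := by
  obtain ⟨r, ⟨hr, hzero⟩, -⟩ := hh
  have hpot : 0 < potential α r :=
    mul_pos (neg_pos.2 (one_div_neg.2 hα)) (Real.rpow_pos_of_pos hr _)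
  have hcentrifugal : 0 ≤ ℓ ^ 2 / (2 * r ^ 2) := by positivity
  linarith

theorem reducesTo_negScale (hℓ : ℓ ≠ 0) (hα : α < 0) (hh : 0 < h) :
    ReducesTo α ℓ h (dualExponent α) ((2 - α) / 2) (negScale α ℓ h)
      (negScale α ℓ h ^ 2 / (α * ℓ ^ 2)) :=
  reducesTo_of_neg hℓ hα (negScale_pos hℓ hα hh) (sq_mul_negScale_rpow hℓ hα hh)

theorem mem_energies_iff_of_neg (hℓ : ℓ ≠ 0) (hα : α < 0) (hh : 0 < h) :
    h ∈ energies α ℓ ↔ (α - 2) / (2 * α) * |ℓ| ^ (2 * α / (α - 2)) < h := by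
  have hc := negScale_pos hℓ hα hh
  have hneg : negScale α ℓ h ^ 2 / (α * ℓ ^ 2) < 0 :=
    div_neg_of_pos_of_neg (by positivity) (mul_neg_of_neg_of_pos hα (by positivity))
  rw [(reducesTo_negScale hℓ hα hh).mem_energies_iff, mem_Ioo, and_iff_left hneg,
    oscPotential_dualExponent_one hα, ← negScale_lt_abs_iff hℓ hα hh, ← div_div,
    div_right_comm, div_lt_div_right_of_neg hα, div_lt_one (by positivity), sq_lt_sq,
    abs_of_pos hc]

theorem energies_eq_of_neg (hℓ : ℓ ≠ 0) (hα : α < 0) :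
    energies α ℓ = Ioi ((α - 2) / (2 * α) * |ℓ| ^ (2 * α / (α - 2))) := by
  have hbound : 0 ≤ (α - 2) / (2 * α) * |ℓ| ^ (2 * α / (α - 2)) :=
    mul_nonneg (div_nonneg_of_nonpos (by linarith) (by linarith)) (by positivity)
  ext h
  exact ⟨fun hh => (mem_energies_iff_of_neg hℓ hα (pos_of_mem_energies hα hh)).1 hh,
    fun hh => (mem_energies_iff_of_neg hℓ hα (hbound.trans_lt hh)).2 hh⟩

theorem isOscReduction_of_neg (hℓ : ℓ ≠ 0) (hα : α < 0) :
    IsOscReduction α ℓ (dualExponent α) ((2 - α) / 2) (negScale α ℓ)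
      fun h => negScale α ℓ h ^ 2 / (α * ℓ ^ 2) where
  isOpen_energies := energies_eq_of_neg hℓ hα ▸ isOpen_Ioi
  convex_energies := energies_eq_of_neg hℓ hα ▸ convex_Ioi _
  reducesTo h hh := reducesTo_negScale hℓ hα (pos_of_mem_energies hα hh)
  analyticOnNhd h hh := ((analyticAt_negPowInv (sq_div_dualExponent_pos hℓ hα)
    (pos_of_mem_energies hα hh)).pow 2).div_const
  deriv_pos h hh := by
    have hh0 := pos_of_mem_energies hα hh
    have hanalytic : AnalyticAt ℝ (negScale α ℓ) h :=
      analyticAt_negPowInv (sq_div_dualExponent_pos hℓ hα) hh0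
    have hscale' : deriv (negScale α ℓ) h < 0 := deriv_negPowInv_neg
      (by linarith [dualExponent_lt_two hα]) (sq_div_dualExponent_pos hℓ hα) hh0
    have hscale := negScale_pos hℓ hα hh0
    rw [((hanalytic.differentiableAt.hasDerivAt.fun_pow 2).div_const (α * ℓ ^ 2)).deriv]
    exact div_pos_of_neg_of_neg (mul_neg_of_pos_of_neg (by positivity) hscale')
      (mul_neg_of_neg_of_pos hα (by positivity))

theorem exists_isOscReduction (hℓ : ℓ ≠ 0) (hα : α ∈ Iio (-2 / 3 : ℝ) ∪ Ioo (1 / 2 : ℝ) 2) :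
    ∃ (β s : ℝ) (c κ : ℝ → ℝ), IsOscReduction α ℓ β s c κ ∧ β ∈ Ioo (1 / 2) 2 ∧
      (α ∈ Ioo (-2 : ℝ) (-2 / 3) ∪ Ioo (1 / 2 : ℝ) 1 → β < 1) ∧
      (α ∈ Iio (-2 : ℝ) ∪ Ioo (1 : ℝ) 2 → 1 < β) := by
  rcases hα with hα | hα
  · have hα' : α < -2 / 3 := hα
    have hα0 : α < 0 := by linarith
    refine ⟨_, _, _, _, isOscReduction_of_neg hℓ hα0,
      ⟨half_lt_dualExponent hα, dualExponent_lt_two hα0⟩, ?_, ?_⟩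
    · rintro (h | h)
      exacts [dualExponent_lt_one ⟨h.1, hα0⟩, by linarith [h.1]]
    · rintro (h | h)
      exacts [one_lt_dualExponent h, by linarith [h.1]]
  · have hα0 : 0 < α := one_half_pos.trans hα.1
    refine ⟨_, _, _, _, isOscReduction_of_pos hℓ hα0 hα.2, hα, ?_, ?_⟩
    · rintro (h | h)
      exacts [by linarith [h.2], h.2]
    · rintro (h | h)
      exacts [by linarith [mem_Iio.1 h], h.1]

end Duality

end ApsidalAngle

end

open ApsidalAngle in
theorem theorem1 (ℓ : ℝ) (hℓ : ℓ ≠ 0) (α : ℝ)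
    (hα : α ∈ Set.Iio (-2 / 3 : ℝ) ∪ Set.Ioo (1 / 2 : ℝ) 2) :
    -- the range of energies, and convergence of the integral defining the apsidal angle
    (0 < α → energies α ℓ =
      Set.Ioo ((α - 2) / (2 * α) * |ℓ| ^ (2 * α / (α - 2))) 0) ∧
    (α < 0 → energies α ℓ =
      Set.Ioi ((α - 2) / (2 * α) * |ℓ| ^ (2 * α / (α - 2)))) ∧
    (∀ h ∈ energies α ℓ, IntervalIntegrable (integrand α ℓ h) MeasureTheory.volume
      (rMinus α ℓ h) (rPlus α ℓ h)) ∧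
    -- monotonicity in the energy
    (MonotoneOn (apsidalAngle α ℓ) (energies α ℓ) ∨
      AntitoneOn (apsidalAngle α ℓ) (energies α ℓ)) ∧
    (α ∈ Set.Ioo (-2 : ℝ) (-2 / 3) ∪ Set.Ioo (1 / 2 : ℝ) 1 →
      DecreasesOn (apsidalAngle α ℓ) (energies α ℓ)) ∧
    (α ∈ Set.Iio (-2 : ℝ) ∪ Set.Ioo (1 : ℝ) 2 →
      IncreasesOn (apsidalAngle α ℓ) (energies α ℓ)) ∧
    -- monotonicity in the eccentricity
    IncreasesOn (eccentricity α ℓ) (energies α ℓ) ∧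
    ∃ T : ℝ → ℝ,
      (∀ h ∈ energies α ℓ, apsidalAngle α ℓ h = T (eccentricity α ℓ h)) ∧
      (MonotoneOn T (eccentricity α ℓ '' energies α ℓ) ∨
        AntitoneOn T (eccentricity α ℓ '' energies α ℓ)) ∧
      (α ∈ Set.Ioo (-2 : ℝ) (-2 / 3) ∪ Set.Ioo (1 / 2 : ℝ) 1 →
        DecreasesOn T (eccentricity α ℓ '' energies α ℓ)) ∧
      (α ∈ Set.Iio (-2 : ℝ) ∪ Set.Ioo (1 : ℝ) 2 →
        IncreasesOn T (eccentricity α ℓ '' energies α ℓ)) := by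
  obtain ⟨β, s, c, κ, H, hβ, hdec, hinc⟩ := exists_isOscReduction hℓ hα
  have hα2 : α < 2 := hα.elim (fun h => h.trans (by norm_num)) fun h => h.2
  have hecc := H.increasesOn_eccentricity
  have hmono := H.monotoneOn_or_antitoneOn_apsidalAngle hβ.1 hβ.2
  have hanti (h : _) := H.decreasesOn_apsidalAngle hβ.1 (hdec h)
  have hincr (h : _) := H.increasesOn_apsidalAngle (hinc h) hβ.2
  have hinv := monotoneOn_invFunOn hecc.1
  have hmaps : Set.MapsTo (Function.invFunOn (eccentricity α ℓ) (energies α ℓ))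
      (eccentricity α ℓ '' energies α ℓ) (energies α ℓ) := fun _ => Function.invFunOn_mem
  refine ⟨fun hα0 => energies_eq_of_pos hℓ hα0 hα2, energies_eq_of_neg hℓ,
    fun h => H.intervalIntegrable_integrand, hmono, hanti, hincr, hecc,
    apsidalAngle α ℓ ∘ Function.invFunOn (eccentricity α ℓ) (energies α ℓ), fun h hh => ?_,
    hmono.imp (fun hΘ => hΘ.comp hinv hmaps) fun hΘ =>
      AntitoneOn.comp_MonotoneOn hΘ hinv hmaps, ?_, ?_⟩
  · exact (congrArg _ (hecc.1.injOn.leftInvOn_invFunOn hh)).symm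
  · exact fun h => (hanti h).comp_invFunOn H.isOpen_energies hecc
      fun _ => H.hasStrictDerivAt_eccentricity
  · exact fun h => (hincr h).comp_invFunOn H.isOpen_energies hecc
      fun _ => H.hasStrictDerivAt_eccentricity
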